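/- Let $n\ge 1$, $0<\sigma<2$, $0<\lambda\le\Lambda$, $\mu>0$; write $B_\delta(x)$ for open balls in $\mathbb R^n$ and $B_\delta=B_\delta(0)$. **The class $\mathcal L$.** Let $\mathcal L=\mathcal L(\sigma,\lambda,\Lambda,\mu)$ be the class of operators $Lu(x)=\int_{\mathbb R^n}\delta_zu(x)K(z)\,dz$, where $\delta_zu(x)=u(x+z)-u(x)$ if $\sigma<1$, $\delta_zu(x)=u(x+z)-u(x)-\mathbf 1_{B_1}(z)\nabla u(x)\cdot z$ if $\sigma=1$, $\delta_zu(x)=u(x+z)-u(x)-\nabla u(x)\cdot z$ if $\sigma>1$, and $K:\mathbb R^n\to[0,\infty)$ is measurable and satisfies, for every $\delta>0$, $$\int_{B_{2\delta}\setminus B_\delta}K(z)\,dz\le(2-\sigma)\Lambda\delta^{-\sigma},\qquad \Big|\int_{B_{2\delta}\setminus B_\delta}zK(z)\,dz\Big|\le\Lambda|1-\sigma|\delta^{1-\sigma},$$ and there is a measurable set $A_\delta=-A_\delta\subset B_{2\delta}\setminus B_\delta$ with $|A_\delta|\ge\mu|B_{2\delta}\setminus B_\delta|$ and $K\ge(2-\sigma)\lambda\delta^{-n-\sigma}$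 on $A_\delta$. Put $M^+_{\mathcal L}u(x)=\sup_{L\in\mathcal L}Lu(x)$ and $M^-_{\mathcal L}u(x)=\inf_{L\in\mathcal L}Lu(x)$ (extended-real valued, with $\sup\emptyset=-\infty$, $\inf\emptyset=+\infty$). **The domain.** Let $\Omega\subset\mathbb R^n$ be a bounded open set (connectedness is not needed) satisfying the uniform exterior ball condition: there is $r_\Omega>0$ such that for every $x\in\partial\Omega$ and $0<r\le r_\Omega$ there is $y\in\Omega^c$ with $\overline{B}_r(y)\cap\overline\Omega=\{x\}$. **The operator.** Let $I(x,r,\varphi(\cdot))\in\mathbb R$ be defined for $x\in\Omega$, $r\in\mathbb R$ and $\varphi\in C^2(B_\delta(x))\cap L^\infty(\mathbb R^n)$ with some $\delta>0$, and assume: - (Uniform ellipticity) there are $C_0\ge0$, with $C_0=0$ if $\sigma<1$, and $m:[0,\infty)\to[0,\infty)$ with $m(0)=0$, continuous at $0$, such that for all $r,s\in\mathbb R$, $x\in\Omega$, $\delta>0$ and $\varphi,\psi\in C^2(B_\delta(x))\cap L^\infty(\mathbb R^n)$, $$\begin{aligned}M^-_{\mathcal L}(\varphi-\psi)(x)-C_0|\nabla(\psi-\varphi)(x)|-m(|r-s|)&\le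 I(x,r,\psi(\cdot))-I(x,s,\varphi(\cdot))\\&\le M^+_{\mathcal L}(\varphi-\psi)(x)+C_0|\nabla(\psi-\varphi)(x)|+m(|r-s|).\end{aligned}$$ - (A0) For all $x\in\Omega$, $\delta>0$ and $\varphi\in C^2(B_\delta(x))\cap L^\infty(\mathbb R^n)$, the function $(y,r)\mapsto I(y,r,\varphi(\cdot))$ is continuous on $(B_\delta(x)\cap\Omega)\times\mathbb R$. - (A2) For all $x\in\Omega$, $\delta>0$ and $\varphi\in C^2(B_\delta(x))\cap L^\infty(\mathbb R^n)$: if $r\le s$, then $I(x,r,\varphi(\cdot))\le I(x,s,\varphi(\cdot))$. - $x\mapsto I(x,0,0)$ is bounded in $\Omega$. Let $g:\mathbb R^n\to\mathbb R$ be bounded and continuous. **Viscosity sub/supersolutions.** A bounded upper semicontinuous $u:\mathbb R^n\to\mathbb R$ is a viscosity subsolution of the Dirichlet problem $$I(x,u(x),u(\cdot))=0\ \text{ in }\Omega,\qquad u=g\ \text{ in }\Omega^c,$$ if $u\le g$ in $\Omega^c$ and $I(x,u(x),\varphi(\cdot))\le0$ whenever $\varphi\in C^2(\mathbb R^n)$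 is bounded and $u-\varphi$ has a maximum over $\mathbb R^n$ at $x\in\Omega$. A bounded lower semicontinuous $u$ is a viscosity supersolution if $u\ge g$ in $\Omega^c$ and $I(x,u(x),\varphi(\cdot))\ge0$ whenever $\varphi\in C^2(\mathbb R^n)$ is bounded and $u-\varphi$ has a minimum over $\mathbb R^n$ at $x\in\Omega$. **Theorem.** The Dirichlet problem admits a viscosity supersolution $\bar u$ and a viscosity subsolution $\underline u$, both bounded and continuous on $\mathbb R^n$, with $\bar u=\underline u=g$ in $\Omega^c$. -/

import Mathlib

open MeasureTheory Set Metric Topology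
open scoped NNReal ENNReal

noncomputable section

namespace NonlocalDirichlet

/-- Euclidean space `ℝⁿ`. -/
abbrev Rn (n : ℕ) : Type := EuclideanSpace ℝ (Fin n)

/-- A real function on `ℝⁿ` that is bounded. -/
def BoundedFun {n : ℕ} (u : Rn n → ℝ) : Prop := ∃ C : ℝ, ∀ x, |u x| ≤ C

/-- The uniform exterior ball condition: there is `r₀ > 0` such that for every boundary point `x`
and every `0 < r ≤ r₀` some closed ball of radius `r`, centred outside `Ω`, meets the closure
of `Ω` exactly at `x`. -/
def UniformExteriorBall {n : ℕ} (Ω : Set (Rn n)) : Prop :=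
  ∃ r₀ : ℝ, 0 < r₀ ∧ ∀ x ∈ frontier Ω, ∀ r : ℝ, 0 < r → r ≤ r₀ →
    ∃ y ∈ Ωᶜ, closedBall y r ∩ closure Ω = {x}

/-- The annulus `B_{2δ} \ B_δ` centred at the origin (`B` denotes open balls). -/
def annulus (n : ℕ) (δ : ℝ) : Set (Rn n) := ball 0 (2 * δ) \ ball 0 δ

/-- The class of kernels `K` of the operators in `𝓛(σ, lam, Lam, mu)`. -/
structure IsKernel {n : ℕ} (σ lam Lam mu : ℝ) (K : Rn n → ℝ) : Prop where
  measurable : Measurable K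
  nonneg : ∀ z, 0 ≤ K z
  /-- Upper bound on annuli. The Lebesgue integral is used, so this includes integrability. -/
  mass_le : ∀ δ : ℝ, 0 < δ →
    ∫⁻ z in annulus n δ, ENNReal.ofReal (K z) ≤ ENNReal.ofReal ((2 - σ) * Lam * δ ^ (-σ))
  /-- Bound on the first moment over annuli (a vector valued integral). -/
  moment_le : ∀ δ : ℝ, 0 < δ →
    ‖∫ z in annulus n δ, K z • z‖ ≤ Lam * |1 - σ| * δ ^ (1 - σ)
  /-- Lower bound on a symmetric subset of proportion at least `mu` of each annulus. -/
  lower : ∀ δ : ℝ, 0 < δ → ∃ A : Set (Rn n), MeasurableSet A ∧ A ⊆ annulus n δ ∧ A = -A ∧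
    ENNReal.ofReal mu * volume (annulus n δ) ≤ volume A ∧
    ∀ z ∈ A, (2 - σ) * lam * δ ^ (-(n : ℝ) - σ) ≤ K z

open Classical in
/-- The difference `δ_z u(x)`, compensated by the gradient according to the order `σ`. -/
def diffQuot {n : ℕ} (σ : ℝ) (u : Rn n → ℝ) (x z : Rn n) : ℝ :=
  if σ < 1 then u (x + z) - u x
  else if σ = 1 then u (x + z) - u x - (if z ∈ ball (0 : Rn n) 1 then fderiv ℝ u x z else 0)
  else u (x + z) - u x - fderiv ℝ u x z

/-- The linear operator `L u(x) = ∫ δ_z u(x) K(z) dz`. -/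
def levyOp {n : ℕ} (σ : ℝ) (K : Rn n → ℝ) (u : Rn n → ℝ) (x : Rn n) : ℝ :=
  ∫ z, diffQuot σ u x z * K z

/-- The maximal operator `M⁺u(x)`, a supremum in the extended reals. -/
def extremalSup {n : ℕ} (σ lam Lam mu : ℝ) (u : Rn n → ℝ) (x : Rn n) : EReal :=
  ⨆ (K : Rn n → ℝ) (_ : IsKernel σ lam Lam mu K), ((levyOp σ K u x : ℝ) : EReal)

/-- The minimal operator `M⁻u(x)`, an infimum in the extended reals. -/
def extremalInf {n : ℕ} (σ lam Lam mu : ℝ) (u : Rn n → ℝ) (x : Rn n) : EReal :=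
  ⨅ (K : Rn n → ℝ) (_ : IsKernel σ lam Lam mu K), ((levyOp σ K u x : ℝ) : EReal)

/-- `φ ∈ C²(B_δ(x)) ∩ L^∞(ℝⁿ)`. -/
def Admissible {n : ℕ} (x : Rn n) (δ : ℝ) (φ : Rn n → ℝ) : Prop :=
  ContDiffOn ℝ 2 φ (ball x δ) ∧ MemLp φ ∞ volume

/-- A modulus of continuity `m : [0, ∞) → [0, ∞)`. Only `m(0) = 0` and continuity at `0` are
required; monotonicity is not. -/
def IsModulus (m : ℝ≥0 → ℝ≥0) : Prop := m 0 = 0 ∧ ContinuousAt m 0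

/-- A nonlocal operator `(x, r, φ) ↦ I(x, r, φ)` on `Ω`. Its values matter only for `x ∈ Ω` and
for bounded `φ` that are `C²` near `x`. -/
abbrev NonlocalOperator (n : ℕ) : Type := Rn n → ℝ → (Rn n → ℝ) → ℝ

/-- Uniform ellipticity of `I` in `Ω` with respect to `𝓛(σ, lam, Lam, mu)`. -/
def UniformlyElliptic {n : ℕ} (σ lam Lam mu : ℝ) (Ω : Set (Rn n)) (I : NonlocalOperator n) :
    Prop :=
  ∃ (C₀ : ℝ) (m : ℝ≥0 → ℝ≥0), 0 ≤ C₀ ∧ (σ < 1 → C₀ = 0) ∧ IsModulus m ∧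
    ∀ (r s : ℝ), ∀ x ∈ Ω, ∀ δ : ℝ, 0 < δ → ∀ φ ψ : Rn n → ℝ,
      Admissible x δ φ → Admissible x δ ψ →
      extremalInf σ lam Lam mu (φ - ψ) x
          - ((C₀ * ‖fderiv ℝ (ψ - φ) x‖ + (m (nndist r s) : ℝ) : ℝ) : EReal)
        ≤ ((I x r ψ - I x s φ : ℝ) : EReal) ∧
      ((I x r ψ - I x s φ : ℝ) : EReal)
        ≤ extremalSup σ lam Lam mu (φ - ψ) x
          + ((C₀ * ‖fderiv ℝ (ψ - φ) x‖ + (m (nndist r s) : ℝ) : ℝ) : EReal)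

/-- Assumption (A0): continuity of `(y, r) ↦ I(y, r, φ)` near `x` (at points of `Ω`, where `I`
is defined) for `φ ∈ C²(B_δ(x)) ∩ L^∞(ℝⁿ)`. -/
def AssumptionA0 {n : ℕ} (Ω : Set (Rn n)) (I : NonlocalOperator n) : Prop :=
  ∀ x ∈ Ω, ∀ δ : ℝ, 0 < δ → ∀ φ : Rn n → ℝ, Admissible x δ φ →
    ContinuousOn (fun p : Rn n × ℝ => I p.1 p.2 φ) ((ball x δ ∩ Ω) ×ˢ univ)

/-- Assumption (A2): monotonicity in the zero order variable. -/
def AssumptionA2 {n : ℕ} (Ω : Set (Rn n)) (I : NonlocalOperator n) : Prop :=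
  ∀ x ∈ Ω, ∀ δ : ℝ, 0 < δ → ∀ φ : Rn n → ℝ, Admissible x δ φ →
    ∀ r s : ℝ, r ≤ s → I x r φ ≤ I x s φ

/-- Viscosity subsolutions of `I = 0` in `Ω`. -/
def IsViscositySub {n : ℕ} (I : NonlocalOperator n) (Ω : Set (Rn n)) (u : Rn n → ℝ) : Prop :=
  BoundedFun u ∧ UpperSemicontinuous u ∧
    ∀ φ : Rn n → ℝ, ContDiff ℝ 2 φ → BoundedFun φ → ∀ x ∈ Ω,
      IsMaxOn (fun y => u y - φ y) univ x → I x (u x) φ ≤ 0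

/-- Viscosity supersolutions of `I = 0` in `Ω`. -/
def IsViscositySuper {n : ℕ} (I : NonlocalOperator n) (Ω : Set (Rn n)) (u : Rn n → ℝ) : Prop :=
  BoundedFun u ∧ LowerSemicontinuous u ∧
    ∀ φ : Rn n → ℝ, ContDiff ℝ 2 φ → BoundedFun φ → ∀ x ∈ Ω,
      IsMinOn (fun y => u y - φ y) univ x → 0 ≤ I x (u x) φ

/-- Viscosity subsolutions of the Dirichlet problem `I = 0` in `Ω`, `u = g` in `Ωᶜ`. -/
def IsDirichletSub {n : ℕ} (I : NonlocalOperator n) (Ω : Set (Rn n)) (g u : Rn n → ℝ) : Prop :=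
  IsViscositySub I Ω u ∧ ∀ x ∈ Ωᶜ, u x ≤ g x

/-- Viscosity supersolutions of the Dirichlet problem `I = 0` in `Ω`, `u = g` in `Ωᶜ`. -/
def IsDirichletSuper {n : ℕ} (I : NonlocalOperator n) (Ω : Set (Rn n)) (g u : Rn n → ℝ) : Prop :=
  IsViscositySuper I Ω u ∧ ∀ x ∈ Ωᶜ, g x ≤ u x

end NonlocalDirichlet

end

open NonlocalDirichlet

/-! It suffices to build supersolutions: passing to `dualOperator` turns them into subsolutions.
Note that `I` is decreasing in `φ`, so a supersolution is a function on which the linear operators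
are very negative.

Everything comes from one barrier, the power `α` of the distance `d` to a ball of radius `R`. If `d`
is small against `R`, the lower bound on `K` over symmetric sets forces mass at least `c d^(-σ)` on
jumps that land in the ball, where the barrier drops from `d^α` to `0` (`exists_cap_mass`,
`norm_le_of_mem_cap`). This contributes at most `-c d^(α-σ)`. All other increments, compensators
included, carry a factor `α` and add at most `C α d^(α-σ)` (`powDist_diff_le`, `envelope_moment`);
the gradient term behaves alike. So for small `α`, the same for all balls, the barrier is a strict
supersolution uniformly over the class (`exists_barrier_constants`). Truncating it at a height `T`
above its value at the point only helps.

The barrier is used twice. A huge distant ball gives a supersolution `w₀ ≥ g` that stays below `T`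
on all of `Ω`. A small exterior ball touching at a boundary point `x₀` gives one that lies above
`g`, is close to `g x₀` at `x₀` and equals `T` away from `x₀`. By compactness of the boundary,
finite minima of the latter are close to `g` on the whole boundary. The infimum of `w₀` and of these
minima for `ε = 1/(k+1)`, replaced by `g` outside `Ω`, is the solution (`exists_super_of_barriers`).
Near a point of `Ω` all but finitely many of them equal `T`, so the infimum is locally a finite
minimum and no limit of viscosity solutions is taken. -/

namespace NonlocalDirichlet

variable {n : ℕ} {σ lam Lam mu : ℝ} {K : Rn n → ℝ}

/-! ### Moments of the kernels near the origin and near infinity -/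

theorem measurableSet_annulus (δ : ℝ) : MeasurableSet (annulus n δ) :=
  measurableSet_ball.diff measurableSet_ball

theorem mem_annulus {δ : ℝ} {z : Rn n} : z ∈ annulus n δ ↔ δ ≤ ‖z‖ ∧ ‖z‖ < 2 * δ := by
  simp [annulus, and_comm]

theorem lintegral_annulus_rpow_le (hK : IsKernel σ lam Lam mu K) {p δ : ℝ} (hp : 0 ≤ p)
    (hδ : 0 < δ) :
    ∫⁻ z in annulus n δ, ENNReal.ofReal (‖z‖ ^ p * K z) ≤
      ENNReal.ofReal (2 ^ p * ((2 - σ) * Lam) * δ ^ (p - σ)) := by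
  calc ∫⁻ z in annulus n δ, ENNReal.ofReal (‖z‖ ^ p * K z)
      ≤ ∫⁻ z in annulus n δ, ENNReal.ofReal ((2 * δ) ^ p) * ENNReal.ofReal (K z) := by
        refine setLIntegral_mono' (measurableSet_annulus δ) fun z hz => ?_
        rw [← ENNReal.ofReal_mul (by positivity)]
        refine ENNReal.ofReal_le_ofReal (mul_le_mul_of_nonneg_right ?_ (hK.nonneg z))
        exact Real.rpow_le_rpow (norm_nonneg z) (mem_annulus.1 hz).2.le hp
    _ = ENNReal.ofReal ((2 * δ) ^ p) * ∫⁻ z in annulus n δ, ENNReal.ofReal (K z) :=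
        lintegral_const_mul _ hK.measurable.ennreal_ofReal
    _ ≤ ENNReal.ofReal ((2 * δ) ^ p) * ENNReal.ofReal ((2 - σ) * Lam * δ ^ (-σ)) := by
        gcongr
        exact hK.mass_le δ hδ
    _ = _ := by
        rw [← ENNReal.ofReal_mul (by positivity), Real.mul_rpow (by norm_num) hδ.le,
          Real.rpow_sub hδ, Real.rpow_neg hδ.le]
        congr 1
        field_simp

/-- Summing the annular bounds gives a geometric series of ratio `t ^ (p - σ)`. It serves balls with
`t = 1/2`, `p > σ`, and their complements with `t = 2`, `p < σ`. -/
theorem lintegral_iUnion_annulus_le (hK : IsKernel σ lam Lam mu K) (hL : 0 ≤ (2 - σ) * Lam)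
    {p ρ t : ℝ} (hp : 0 ≤ p) (hρ : 0 < ρ) (ht : 0 < t) (ht1 : t ^ (p - σ) < 1) :
    ∫⁻ z in ⋃ j : ℕ, annulus n (ρ * t ^ j), ENNReal.ofReal (‖z‖ ^ p * K z) ≤
      ENNReal.ofReal (2 ^ p * ((2 - σ) * Lam) / (1 - t ^ (p - σ)) * ρ ^ (p - σ)) := by
  have hq : 0 ≤ t ^ (p - σ) := by positivity
  calc ∫⁻ z in ⋃ j : ℕ, annulus n (ρ * t ^ j), ENNReal.ofReal (‖z‖ ^ p * K z)
      ≤ ∑' j : ℕ, ∫⁻ z in annulus n (ρ * t ^ j), ENNReal.ofReal (‖z‖ ^ p * K z) :=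
        lintegral_iUnion_le _ _
    _ ≤ ∑' j : ℕ, ENNReal.ofReal (2 ^ p * ((2 - σ) * Lam) * ρ ^ (p - σ) *
          (t ^ (p - σ)) ^ j) := by
        refine ENNReal.tsum_le_tsum fun j => ?_
        refine (lintegral_annulus_rpow_le hK hp (by positivity)).trans_eq ?_
        rw [Real.mul_rpow hρ.le (by positivity), ← Real.rpow_natCast t j,
          ← Real.rpow_mul ht.le, ← Real.rpow_natCast _ j, ← Real.rpow_mul ht.le,
          mul_comm (j : ℝ), mul_assoc (2 ^ p * ((2 - σ) * Lam))]
    _ = ENNReal.ofReal (∑' j : ℕ, 2 ^ p * ((2 - σ) * Lam) * ρ ^ (p - σ) *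
          (t ^ (p - σ)) ^ j) := by
        rw [ENNReal.ofReal_tsum_of_nonneg (fun j => by positivity)]
        exact (summable_geometric_of_lt_one hq ht1).mul_left _
    _ = _ := by
        rw [tsum_mul_left, tsum_geometric_of_lt_one hq ht1]
        congr 1
        ring

/-- The constant in the moment bounds of a kernel. -/
noncomputable def momentConst (σ Lam p t : ℝ) : ℝ := 2 ^ p * ((2 - σ) * Lam) / (1 - t ^ (p - σ))

theorem momentConst_nonneg (hL : 0 ≤ (2 - σ) * Lam) {p t : ℝ} (ht1 : t ^ (p - σ) < 1) :
    0 ≤ momentConst σ Lam p t :=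
  div_nonneg (by positivity) (by linarith)

theorem ball_subset_iUnion_annulus {ρ : ℝ} (hρ : 0 < ρ) :
    ball (0 : Rn n) ρ ⊆ {0} ∪ ⋃ j : ℕ, annulus n (ρ / 2 * (1 / 2) ^ j) := by
  intro z hz
  rcases eq_or_ne z 0 with rfl | h0
  · simp
  right
  have hz' : ‖z‖ < ρ := by simpa using hz
  have hpos : 0 < ‖z‖ := norm_pos_iff.2 h0
  obtain ⟨k, hk1, hk2⟩ := exists_mem_Ico_zpow (x := ‖z‖ / ρ) (y := (2 : ℝ)) (by positivity)
    (by norm_num)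
  have hk : k < 0 := by
    by_contra hk
    have : (1 : ℝ) ≤ 2 ^ k := one_le_zpow₀ (by norm_num) (by omega)
    have : ‖z‖ / ρ < 1 := (div_lt_one hρ).2 hz'
    linarith
  obtain ⟨j, rfl⟩ : ∃ j : ℕ, k = -((j : ℤ) + 1) := ⟨(-k - 1).toNat, by omega⟩
  rw [le_div_iff₀ hρ] at hk1
  rw [div_lt_iff₀ hρ] at hk2
  have e1 : (2 : ℝ) ^ (-((j : ℤ) + 1)) = 1 / 2 * (1 / 2) ^ j := by
    rw [zpow_neg, zpow_add₀ (by norm_num), one_div, inv_pow]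
    simp [mul_comm]
  have e2 : (2 : ℝ) ^ (-((j : ℤ) + 1) + 1) = (1 / 2) ^ j := by
    rw [neg_add, neg_add_cancel_right, zpow_neg, one_div, inv_pow]
    simp
  rw [e1] at hk1
  rw [e2] at hk2
  exact mem_iUnion.2 ⟨j, mem_annulus.2 ⟨by linarith, by linarith⟩⟩

theorem compl_ball_subset_iUnion_annulus {ρ : ℝ} (hρ : 0 < ρ) :
    (ball (0 : Rn n) ρ)ᶜ ⊆ ⋃ j : ℕ, annulus n (ρ * 2 ^ j) := by
  intro z hz
  have hz' : ρ ≤ ‖z‖ := by simpa using hz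
  obtain ⟨j, hj1, hj2⟩ := exists_nat_pow_near (x := ‖z‖ / ρ) (y := (2 : ℝ))
    ((one_le_div hρ).2 hz') (by norm_num)
  rw [le_div_iff₀ hρ] at hj1
  rw [div_lt_iff₀ hρ] at hj2
  refine mem_iUnion.2 ⟨j, mem_annulus.2 ⟨by linarith, ?_⟩⟩
  rw [pow_succ] at hj2
  linarith

theorem lintegral_ball_rpow_le (hK : IsKernel σ lam Lam mu K) (hL : 0 ≤ (2 - σ) * Lam)
    {p ρ : ℝ} (hp : 0 < p) (hσp : σ < p) (hρ : 0 < ρ) :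
    ∫⁻ z in ball 0 ρ, ENNReal.ofReal (‖z‖ ^ p * K z) ≤
      ENNReal.ofReal (momentConst σ Lam p (1 / 2) * ρ ^ (p - σ)) := by
  have ht1 : (1 / 2 : ℝ) ^ (p - σ) < 1 :=
    Real.rpow_lt_one (by norm_num) (by norm_num) (by linarith)
  -- The annuli miss the origin, where the integrand vanishes because `p > 0`.
  have h0 : ∫⁻ z in {(0 : Rn n)}, ENNReal.ofReal (‖z‖ ^ p * K z) = 0 := by
    refine setLIntegral_eq_zero (measurableSet_singleton _) ?_
    rintro z rfl
    simp [Real.zero_rpow hp.ne']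
  calc ∫⁻ z in ball 0 ρ, ENNReal.ofReal (‖z‖ ^ p * K z)
      ≤ ∫⁻ z in {0} ∪ ⋃ j : ℕ, annulus n (ρ / 2 * (1 / 2) ^ j),
          ENNReal.ofReal (‖z‖ ^ p * K z) := lintegral_mono_set (ball_subset_iUnion_annulus hρ)
    _ ≤ _ + _ := lintegral_union_le _ _ _
    _ ≤ 0 + ENNReal.ofReal (momentConst σ Lam p (1 / 2) * (ρ / 2) ^ (p - σ)) := by
        rw [h0]
        gcongr
        exact lintegral_iUnion_annulus_le hK hL hp.le (by positivity) (by norm_num) ht1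
    _ ≤ _ := by
        rw [zero_add]
        refine ENNReal.ofReal_le_ofReal (mul_le_mul_of_nonneg_left ?_ (momentConst_nonneg hL ht1))
        exact Real.rpow_le_rpow (by positivity) (by linarith) (by linarith)

theorem lintegral_compl_ball_rpow_le (hK : IsKernel σ lam Lam mu K) (hL : 0 ≤ (2 - σ) * Lam)
    {p ρ : ℝ} (hp : 0 ≤ p) (hσp : p < σ) (hρ : 0 < ρ) :
    ∫⁻ z in (ball 0 ρ)ᶜ, ENNReal.ofReal (‖z‖ ^ p * K z) ≤
      ENNReal.ofReal (momentConst σ Lam p 2 * ρ ^ (p - σ)) :=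
  (lintegral_mono_set (compl_ball_subset_iUnion_annulus hρ)).trans
    (lintegral_iUnion_annulus_le hK hL hp hρ (by norm_num)
      (Real.rpow_lt_one_of_one_lt_of_neg (by norm_num) (by linarith)))

theorem integral_bound_of_lintegral {s : Set (Rn n)} {f : Rn n → ℝ} (hf : Measurable f)
    (hf0 : ∀ z, 0 ≤ f z) {C : ℝ} (hC : 0 ≤ C)
    (h : ∫⁻ z in s, ENNReal.ofReal (f z) ≤ ENNReal.ofReal C) :
    IntegrableOn f s ∧ ∫ z in s, f z ≤ C := by
  constructor
  · refine ⟨hf.aestronglyMeasurable, ?_⟩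
    rw [hasFiniteIntegral_iff_ofReal (Filter.Eventually.of_forall hf0)]
    exact h.trans_lt ENNReal.ofReal_lt_top
  · rw [integral_eq_lintegral_of_nonneg_ae (Filter.Eventually.of_forall hf0)
      hf.aestronglyMeasurable]
    exact ENNReal.toReal_le_of_le_ofReal hC h

theorem measurable_rpow_mul (hK : IsKernel σ lam Lam mu K) (p : ℝ) :
    Measurable fun z : Rn n => ‖z‖ ^ p * K z :=
  (measurable_norm.pow_const p).mul hK.measurable

theorem rpow_mul_nonneg (hK : IsKernel σ lam Lam mu K) (p : ℝ) (z : Rn n) :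
    0 ≤ ‖z‖ ^ p * K z :=
  mul_nonneg (by positivity) (hK.nonneg z)

theorem near_moment (hK : IsKernel σ lam Lam mu K) (hL : 0 ≤ (2 - σ) * Lam)
    {p ρ : ℝ} (hp : 0 < p) (hσp : σ < p) (hρ : 0 < ρ) :
    IntegrableOn (fun z => ‖z‖ ^ p * K z) (ball 0 ρ) ∧
      ∫ z in ball 0 ρ, ‖z‖ ^ p * K z ≤ momentConst σ Lam p (1 / 2) * ρ ^ (p - σ) :=
  integral_bound_of_lintegral (measurable_rpow_mul hK p) (rpow_mul_nonneg hK p)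
    (mul_nonneg (momentConst_nonneg hL
      (Real.rpow_lt_one (by norm_num) (by norm_num) (by linarith))) (by positivity))
    (lintegral_ball_rpow_le hK hL hp hσp hρ)

theorem far_moment (hK : IsKernel σ lam Lam mu K) (hL : 0 ≤ (2 - σ) * Lam)
    {p ρ : ℝ} (hp : 0 ≤ p) (hσp : p < σ) (hρ : 0 < ρ) :
    IntegrableOn (fun z => ‖z‖ ^ p * K z) (ball 0 ρ)ᶜ ∧
      ∫ z in (ball 0 ρ)ᶜ, ‖z‖ ^ p * K z ≤ momentConst σ Lam p 2 * ρ ^ (p - σ) :=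
  integral_bound_of_lintegral (measurable_rpow_mul hK p) (rpow_mul_nonneg hK p)
    (mul_nonneg (momentConst_nonneg hL
      (Real.rpow_lt_one_of_one_lt_of_neg (by norm_num) (by linarith))) (by positivity))
    (lintegral_compl_ball_rpow_le hK hL hp hσp hρ)

theorem integrableOn_annulus (hK : IsKernel σ lam Lam mu K) {δ : ℝ} (hδ : 0 < δ) :
    IntegrableOn K (annulus n δ) := by
  refine ⟨hK.measurable.aestronglyMeasurable, ?_⟩
  rw [hasFiniteIntegral_iff_ofReal (Filter.Eventually.of_forall hK.nonneg)]
  exact (hK.mass_le δ hδ).trans_lt ENNReal.ofReal_lt_top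

theorem integrableOn_annulus_linear (hK : IsKernel σ lam Lam mu K) {δ : ℝ} (hδ : 0 < δ) :
    IntegrableOn (fun z => K z • z) (annulus n δ) := by
  refine Integrable.mono' ((integrableOn_annulus hK hδ).mul_const (2 * δ))
    (hK.measurable.smul measurable_id).aestronglyMeasurable ?_
  filter_upwards [ae_restrict_mem (measurableSet_annulus δ)] with z hz
  rw [norm_smul, Real.norm_of_nonneg (hK.nonneg z)]
  exact mul_le_mul_of_nonneg_left (mem_annulus.1 hz).2.le (hK.nonneg z)

/-! ### Order one: changing the cut-off radius of the compensator -/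

/-- For `σ = 1` first moments over annuli vanish. -/
theorem annulus_first_moment (hK : IsKernel 1 lam Lam mu K) {δ : ℝ} (hδ : 0 < δ)
    (l : Rn n →L[ℝ] ℝ) :
    IntegrableOn (fun z => l z * K z) (annulus n δ) ∧ ∫ z in annulus n δ, l z * K z = 0 := by
  have h := integrableOn_annulus_linear hK hδ
  have e : (fun z => l z * K z) = fun z => l (K z • z) := by
    ext z
    rw [map_smul, smul_eq_mul, mul_comm]
  rw [e]
  refine ⟨l.integrable_comp h, ?_⟩
  rw [l.integral_comp_comm h]
  have := hK.moment_le δ hδ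
  rw [sub_self, abs_zero, mul_zero, zero_mul, norm_le_zero_iff] at this
  rw [this, map_zero]

open Classical in
/-- The difference between the indicators of the unit ball and of a dyadic ball. -/
noncomputable def ballGap (n : ℕ) (ρ : ℝ) (z : Rn n) : ℝ :=
  (if z ∈ ball (0 : Rn n) 1 then 1 else 0) - (if z ∈ ball (0 : Rn n) ρ then 1 else 0)

theorem ballGap_double {ρ : ℝ} (hρ : 0 < ρ) (z : Rn n) :
    ballGap n (2 * ρ) z = ballGap n ρ z - (annulus n ρ).indicator 1 z := by
  classical
  by_cases h1 : ‖z‖ < ρ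
  · have h2 : ‖z‖ < 2 * ρ := by linarith
    simp [ballGap, h1, h2, indicator, mem_annulus, not_le.2 h1]
  · by_cases h2 : ‖z‖ < 2 * ρ <;>
    simp [ballGap, h1, h2, indicator, mem_annulus, not_lt.1 h1]

/-- For `σ = 1` the gradient is cut off at radius `1`, whereas estimates at scale `d` need a cut-off
near `d`. Doubling the radius changes the integral by an annular first moment, which is zero;
starting from `1`, this reaches exactly the powers of two. -/
theorem ballGap_moment (hK : IsKernel 1 lam Lam mu K) (k : ℤ) (l : Rn n →L[ℝ] ℝ) :
    Integrable (fun z => ballGap n (2 ^ k) z * (l z * K z)) ∧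
      ∫ z, ballGap n (2 ^ k) z * (l z * K z) = 0 := by
  have step : ∀ k : ℤ, (fun z => ballGap n (2 ^ (k + 1)) z * (l z * K z)) =
      fun z => ballGap n (2 ^ k) z * (l z * K z) -
        (annulus n (2 ^ k)).indicator (fun z => l z * K z) z := by
    intro k
    ext z
    rw [zpow_add₀ (by norm_num), zpow_one, mul_comm (_ : ℝ) 2, ballGap_double (by positivity),
      sub_mul]
    congr 1
    by_cases hz : z ∈ annulus n (2 ^ k) <;> simp [hz]
  have ann : ∀ k : ℤ, Integrable ((annulus n (2 ^ k)).indicator (fun z => l z * K z)) ∧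
      ∫ z, (annulus n (2 ^ k)).indicator (fun z => l z * K z) z = 0 := fun k => by
    have h := annulus_first_moment hK (δ := 2 ^ k) (by positivity) l
    exact ⟨h.1.integrable_indicator (measurableSet_annulus _),
      (integral_indicator (measurableSet_annulus _)).trans h.2⟩
  induction k using Int.induction_on with
  | zero => simp [ballGap]
  | succ k ih =>
    rw [step]
    exact ⟨ih.1.sub (ann k).1, by rw [integral_sub ih.1 (ann k).1, ih.2, (ann k).2, sub_zero]⟩
  | pred k ih =>
    have h := step (-(k : ℤ) - 1)
    rw [sub_add_cancel] at h
    have h' : (fun z => ballGap n (2 ^ (-(k : ℤ) - 1)) z * (l z * K z)) =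
        fun z => ballGap n (2 ^ (-(k : ℤ))) z * (l z * K z) +
          (annulus n (2 ^ (-(k : ℤ) - 1))).indicator (fun z => l z * K z) z := by
      ext z
      have := congrFun h z
      linarith
    rw [h']
    have a := ann (-(k : ℤ) - 1)
    exact ⟨ih.1.add a.1, by rw [integral_add ih.1 a.1, ih.2, a.2, add_zero]⟩

/-! ### Kernel mass in a half space, uniformly in the direction -/

/-- The part of `B_{2δ}` lying within distance `θδ` of the hyperplane orthogonal to `N`. -/
def slab (N : Rn n) (θ δ : ℝ) : Set (Rn n) := {z | ‖z‖ < 2 * δ ∧ |inner ℝ N z| < θ * δ}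

theorem volume_hyperplane {e : Rn n} (he : e ≠ 0) : volume {z : Rn n | inner ℝ e z = 0} = 0 := by
  have h : {z : Rn n | inner ℝ e z = 0} = (LinearMap.ker (innerSL ℝ e).toLinearMap : Set (Rn n)) := by
    ext z; simp
  rw [h]
  refine Measure.addHaar_submodule _ _ fun htop => he ?_
  have : e ∈ LinearMap.ker (innerSL ℝ e).toLinearMap := by rw [htop]; trivial
  simpa using this

theorem measurableSet_slab (N : Rn n) (θ δ : ℝ) : MeasurableSet (slab N θ δ) :=
  ((isOpen_lt (f := fun z : Rn n => ‖z‖) (by fun_prop) continuous_const).inter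
    (isOpen_lt (f := fun z : Rn n => |inner ℝ N z|) (by fun_prop)
      continuous_const)).measurableSet

/-- Continuity of measure from above: the slabs decrease to a piece of a hyperplane, which is null.
-/
theorem exists_volume_slab_le {e : Rn n} (he : e ≠ 0) {η : ℝ≥0∞} (hη : 0 < η) :
    ∃ θ : ℝ, 0 < θ ∧ θ ≤ 1 ∧ volume (slab e θ 1) ≤ η := by
  have hanti : Antitone fun k : ℕ => slab e (1 / ((k : ℝ) + 1)) 1 := by
    intro j k hjk z hz
    refine ⟨hz.1, hz.2.trans_le ?_⟩
    have := one_div_le_one_div_of_le (by positivity : (0 : ℝ) < j + 1)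
      (by exact_mod_cast Nat.succ_le_succ hjk : (j : ℝ) + 1 ≤ k + 1)
    linarith
  have hfin : volume (slab e (1 / (((0 : ℕ) : ℝ) + 1)) 1) ≠ ∞ :=
    ((measure_mono (fun z hz => by simpa using hz.1)).trans_lt
      (measure_ball_lt_top (x := (0 : Rn n)) (r := 2))).ne
  have hlim := tendsto_measure_iInter_atTop (μ := (volume : Measure (Rn n)))
    (fun k : ℕ => (measurableSet_slab e (1 / ((k : ℝ) + 1)) 1).nullMeasurableSet) hanti ⟨0, hfin⟩
  have hzero : volume (⋂ k : ℕ, slab e (1 / ((k : ℝ) + 1)) 1) = 0 := by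
    refine measure_mono_null (fun z hz => ?_) (volume_hyperplane he)
    by_contra hne
    obtain ⟨k, hk⟩ := exists_nat_one_div_lt (abs_pos.2 hne)
    have := (mem_iInter.1 hz k).2
    linarith
  rw [hzero] at hlim
  obtain ⟨k, hk⟩ := (hlim.eventually (gt_mem_nhds hη)).exists
  refine ⟨1 / ((k : ℝ) + 1), by positivity, ?_, hk.le⟩
  rw [div_le_one (by positivity)]
  linarith [Nat.cast_nonneg (α := ℝ) k]

/-- The reflection exchanging `N` and `e` carries one slab to the other, so a single `θ` serves all
directions. -/
theorem volume_slab_eq {e N : Rn n} (h : ‖N‖ = ‖e‖) (θ δ : ℝ) :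
    volume (slab N θ δ) = volume (slab e θ δ) := by
  let L := (ℝ ∙ (N - e))ᗮ.reflection
  have hL : L N = e := Submodule.reflection_sub h
  have : slab N θ δ = L ⁻¹' slab e θ δ := by
    ext z
    have : inner ℝ e (L z) = inner ℝ N z := by rw [← hL, L.inner_map_map]
    simp only [slab, mem_ofPred_eq, mem_preimage, L.norm_map, this]
  rw [this]
  exact L.measurePreserving.measure_preimage (measurableSet_slab e θ δ).nullMeasurableSet

open Pointwise in
theorem slab_eq_smul (N : Rn n) (θ : ℝ) {δ : ℝ} (hδ : 0 < δ) : slab N θ δ = δ • slab N θ 1 := by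
  ext z
  rw [mem_smul_set_iff_inv_smul_mem₀ hδ.ne']
  simp only [slab, mem_ofPred_eq, norm_smul, inner_smul_right, norm_inv, Real.norm_of_nonneg hδ.le,
    abs_mul, abs_inv, abs_of_pos hδ, mul_one, inv_mul_lt_iff₀ hδ]
  rw [mul_comm δ, mul_comm δ]

open Pointwise in
theorem annulus_eq_smul {δ : ℝ} (hδ : 0 < δ) : annulus n δ = δ • annulus n 1 := by
  ext z
  rw [mem_smul_set_iff_inv_smul_mem₀ hδ.ne']
  simp only [mem_annulus, norm_smul, norm_inv, Real.norm_of_nonneg hδ.le, inv_mul_lt_iff₀ hδ,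
    le_inv_mul_iff₀ hδ, mul_one]
  rw [mul_comm δ 2]

open Pointwise in
theorem volume_smul {δ : ℝ} (hδ : 0 < δ) (s : Set (Rn n)) :
    volume (δ • s) = ENNReal.ofReal (δ ^ n) * volume s := by
  rw [Measure.addHaar_smul, abs_of_pos (by positivity), finrank_euclideanSpace_fin]

theorem volume_annulus_one_pos (hn : 1 ≤ n) : 0 < volume (annulus n 1) := by
  refine lt_of_lt_of_le (measure_ball_pos volume
    (EuclideanSpace.single (⟨0, hn⟩ : Fin n) (3 / 2 : ℝ)) (by norm_num : (0 : ℝ) < 1 / 2))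
    (measure_mono fun z hz => ?_)
  have h1 : ‖EuclideanSpace.single (⟨0, hn⟩ : Fin n) (3 / 2 : ℝ)‖ = 3 / 2 := by
    rw [PiLp.norm_single]; norm_num
  rw [mem_ball, dist_eq_norm] at hz
  have := abs_norm_sub_norm_le z (EuclideanSpace.single (⟨0, hn⟩ : Fin n) (3 / 2 : ℝ))
  rw [h1, abs_le] at this
  exact mem_annulus.2 ⟨by linarith, by linarith⟩

/-- The part of an annulus lying well inside the half space opposite to `N`. -/
def cap (N : Rn n) (θ δ : ℝ) : Set (Rn n) := {z | z ∈ annulus n δ ∧ inner ℝ N z ≤ -(θ * δ)}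

theorem measurableSet_cap (N : Rn n) (θ δ : ℝ) : MeasurableSet (cap N θ δ) :=
  (measurableSet_annulus δ).inter
    (isClosed_le (f := fun z : Rn n => inner ℝ N z) (by fun_prop)
      continuous_const).measurableSet

/-- Outside the slab, `A` consists of its part in the cap and the mirror image of that part, of
equal measure since `A = -A`. The slab uses up at most half of the guaranteed proportion `m`, and
the rest is shared equally. -/
theorem volume_inter_cap_ge {N : Rn n} {θ δ m : ℝ} {A : Set (Rn n)}
    (hm : 0 ≤ m)
    (hAs : A ⊆ annulus n δ) (hAneg : A = -A)
    (hA : ENNReal.ofReal m * volume (annulus n δ) ≤ volume A)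
    (hslab : volume (slab N θ δ) ≤ ENNReal.ofReal (m / 2) * volume (annulus n δ)) :
    m / 4 * volume.real (annulus n δ) ≤ volume.real (A ∩ cap N θ δ) := by
  have hfa : volume (annulus n δ) ≠ ∞ :=
    ((measure_mono sdiff_subset).trans_lt (measure_ball_lt_top (x := (0 : Rn n)) (r := 2 * δ))).ne
  have hfA : volume A ≠ ∞ := ((measure_mono hAs).trans_lt hfa.lt_top).ne
  have hneg : volume (-(A ∩ cap N θ δ)) = volume (A ∩ cap N θ δ) := Measure.measure_neg _ _
  have hcover : A ⊆ (A ∩ cap N θ δ) ∪ (-(A ∩ cap N θ δ)) ∪ slab N θ δ := by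
    intro z hz
    have hzn : -z ∈ A := by rw [hAneg] at hz; exact hz
    have hza := hAs hz
    rcases le_or_gt (inner ℝ N z) (-(θ * δ)) with h | h
    · exact Or.inl (Or.inl ⟨hz, hza, h⟩)
    rcases le_or_gt (θ * δ) (inner ℝ N z) with h' | h'
    · refine Or.inl (Or.inr ⟨hzn, hAs hzn, ?_⟩)
      rw [inner_neg_right]
      linarith
    · exact Or.inr ⟨(mem_annulus.1 hza).2, abs_lt.2 ⟨h, h'⟩⟩
  have h1 : volume A ≤ volume (A ∩ cap N θ δ) + volume (A ∩ cap N θ δ) +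
      ENNReal.ofReal (m / 2) * volume (annulus n δ) := by
    refine (measure_mono hcover).trans ((measure_union_le _ _).trans (add_le_add ?_ hslab))
    exact (measure_union_le _ _).trans_eq (by rw [hneg])
  have hfc : volume (A ∩ cap N θ δ) ≠ ∞ :=
    ((measure_mono inter_subset_left).trans_lt hfA.lt_top).ne
  have hfs : ENNReal.ofReal (m / 2) * volume (annulus n δ) ≠ ∞ :=
    ENNReal.mul_ne_top ENNReal.ofReal_ne_top hfa
  have h2 := ENNReal.toReal_mono (ENNReal.add_ne_top.2 ⟨ENNReal.add_ne_top.2 ⟨hfc, hfc⟩, hfs⟩)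
    (hA.trans h1)
  rw [ENNReal.toReal_add (ENNReal.add_ne_top.2 ⟨hfc, hfc⟩) hfs, ENNReal.toReal_add hfc hfc,
    ENNReal.toReal_mul, ENNReal.toReal_mul, ENNReal.toReal_ofReal hm,
    ENNReal.toReal_ofReal (by positivity)] at h2
  simp only [measureReal_def]
  linarith

open Pointwise in
theorem exists_cap_mass (hn : 1 ≤ n) (hσ2 : σ < 2) (hlam : 0 < lam) (hmu : 0 < mu) :
    ∃ θ c : ℝ, 0 < θ ∧ θ ≤ 1 ∧ 0 < c ∧ ∀ (Lam : ℝ) (K : Rn n → ℝ), IsKernel σ lam Lam mu K →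
      ∀ N : Rn n, ‖N‖ = 1 → ∀ δ : ℝ, 0 < δ → c * δ ^ (-σ) ≤ ∫ z in cap N θ δ, K z := by
  have hV := volume_annulus_one_pos hn
  have hVfin : volume (annulus n 1) ≠ ∞ :=
    ((measure_mono sdiff_subset).trans_lt (measure_ball_lt_top (x := (0 : Rn n)) (r := 2 * 1))).ne
  set e : Rn n := EuclideanSpace.single (⟨0, hn⟩ : Fin n) (1 : ℝ) with he
  have he1 : ‖e‖ = 1 := by rw [he, PiLp.norm_single]; norm_num
  obtain ⟨θ, hθ, hθ1, hslab⟩ := exists_volume_slab_le (e := e) (by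
    rw [← norm_ne_zero_iff, he1]; norm_num)
    (ENNReal.mul_pos (ENNReal.ofReal_pos.2 (half_pos hmu)).ne' hV.ne')
  have hVr : 0 < volume.real (annulus n 1) := ENNReal.toReal_pos hV.ne' hVfin
  refine ⟨θ, (2 - σ) * lam * (mu / 4 * volume.real (annulus n 1)), hθ, hθ1,
    by have := sub_pos.2 hσ2; positivity, fun Lam K hK N hN δ hδ => ?_⟩
  obtain ⟨A, hAm, hAs, hAneg, hA, hAK⟩ := hK.lower δ hδ
  have hsl : volume (slab N θ δ) ≤ ENNReal.ofReal (mu / 2) * volume (annulus n δ) := by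
    rw [slab_eq_smul N θ hδ, annulus_eq_smul hδ, volume_smul hδ, volume_smul hδ,
      volume_slab_eq (hN.trans he1.symm), mul_left_comm]
    gcongr
  have hvol := volume_inter_cap_ge hmu.le hAs hAneg hA hsl
  have hint := integrableOn_annulus hK hδ
  have hcapm : MeasurableSet (A ∩ cap N θ δ) := hAm.inter (measurableSet_cap N θ δ)
  have hc0 : 0 ≤ (2 - σ) * lam * δ ^ (-(n : ℝ) - σ) := by have := sub_pos.2 hσ2; positivity
  have hAfin : volume (A ∩ cap N θ δ) ≠ ∞ :=
    ((measure_mono (inter_subset_left.trans (hAs.trans sdiff_subset))).trans_lt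
      (measure_ball_lt_top (x := (0 : Rn n)) (r := 2 * δ))).ne
  have hcapint : IntegrableOn K (cap N θ δ) := hint.mono_set fun z hz => hz.1
  calc (2 - σ) * lam * (mu / 4 * volume.real (annulus n 1)) * δ ^ (-σ)
      = (2 - σ) * lam * δ ^ (-(n : ℝ) - σ) * (mu / 4 * volume.real (annulus n δ)) := by
        rw [annulus_eq_smul hδ, measureReal_def volume (δ • _), volume_smul hδ, ENNReal.toReal_mul,
          ENNReal.toReal_ofReal (by positivity), sub_eq_add_neg (-(n : ℝ)), Real.rpow_add hδ,
          Real.rpow_neg hδ.le (n : ℝ), Real.rpow_natCast, ← measureReal_def]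
        field_simp
    _ ≤ (2 - σ) * lam * δ ^ (-(n : ℝ) - σ) * volume.real (A ∩ cap N θ δ) := by gcongr
    _ = ∫ z in A ∩ cap N θ δ, (2 - σ) * lam * δ ^ (-(n : ℝ) - σ) := by
        rw [setIntegral_const, smul_eq_mul, mul_comm]
    _ ≤ ∫ z in A ∩ cap N θ δ, K z :=
        setIntegral_mono_on (integrableOn_const hAfin)
          (hcapint.mono_set inter_subset_right) hcapm fun z hz => hAK z hz.1
    _ ≤ ∫ z in cap N θ δ, K z :=
        setIntegral_mono_set hcapint (Filter.Eventually.of_forall hK.nonneg)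
          (Filter.Eventually.of_forall inter_subset_right)

/-! ### Increments of a power of the distance to a ball -/

/-- Bernoulli's inequality with exponent `b / α ≥ 1`, followed by subadditivity of the power `b`.
The point is the factor `α`: positive increments become negligible as `α` tends to `0`. -/
theorem rpow_growth {α b d t : ℝ} (hα : 0 < α) (hαb : α ≤ b) (hb1 : b ≤ 1) (hd : 0 < d)
    (ht : 0 ≤ t) : (d + t) ^ α - d ^ α ≤ α / b * (d ^ α * (t / d) ^ b) := by
  have hb : 0 < b := hα.trans_le hαb
  have hs : 0 ≤ t / d := by positivity
  have h1 : 1 + b / α * ((1 + t / d) ^ α - 1) ≤ (1 + t / d) ^ b := by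
    have := one_add_mul_self_le_rpow_one_add (s := (1 + t / d) ^ α - 1) (p := b / α)
      (by linarith [Real.rpow_nonneg (by linarith : 0 ≤ 1 + t / d) α]) ((one_le_div hα).2 hαb)
    rwa [add_sub_cancel, ← Real.rpow_mul (by linarith), mul_div_cancel₀ _ hα.ne'] at this
  have h2 : (1 + t / d) ^ b ≤ 1 + (t / d) ^ b := by
    simpa using Real.rpow_add_le_add_rpow zero_le_one hs hb.le hb1
  have h3 : (1 + t / d) ^ α - 1 ≤ α / b * (t / d) ^ b := by
    have : b / α * ((1 + t / d) ^ α - 1) ≤ (t / d) ^ b := by linarith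
    calc (1 + t / d) ^ α - 1 = α / b * (b / α * ((1 + t / d) ^ α - 1)) := by field_simp
      _ ≤ _ := by gcongr
  have h4 : (d + t) ^ α = d ^ α * (1 + t / d) ^ α := by
    rw [← Real.mul_rpow hd.le (by linarith)]
    congr 1
    field_simp
  have := mul_le_mul_of_nonneg_left h3 (Real.rpow_nonneg hd.le α)
  rw [h4]
  linarith

theorem rpow_le_tangent {α d s : ℝ} (hα : 0 ≤ α) (hα1 : α ≤ 1) (hd : 0 < d) (hs : 0 ≤ s) :
    s ^ α ≤ d ^ α + α * (d ^ α / d) * (s - d) := by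
  have h := rpow_one_add_le_one_add_mul_self (s := s / d - 1) (p := α)
    (by linarith [div_nonneg hs hd.le]) hα hα1
  rw [add_sub_cancel, Real.div_rpow hs hd.le, div_le_iff₀ (by positivity)] at h
  refine h.trans_eq ?_
  field_simp

/-- This is `2 ‖v‖ ‖v + z‖ ≤ ‖v‖² + ‖v + z‖²` with the last square expanded. -/
theorem norm_add_le_second_order {v z : Rn n} (hv : 0 < ‖v‖) :
    ‖v + z‖ ≤ ‖v‖ + inner ℝ (‖v‖⁻¹ • v) z + ‖z‖ ^ 2 / (2 * ‖v‖) := by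
  have h : ‖v + z‖ ^ 2 = ‖v‖ ^ 2 + 2 * inner ℝ v z + ‖z‖ ^ 2 := norm_add_sq_real v z
  have h2 : 2 * (‖v‖ * ‖v + z‖) ≤ ‖v‖ ^ 2 + ‖v + z‖ ^ 2 := by nlinarith [sq_nonneg (‖v‖ - ‖v + z‖)]
  rw [real_inner_smul_left]
  have : ‖v + z‖ = (2 * (‖v‖ * ‖v + z‖)) / (2 * ‖v‖) := by field_simp
  rw [this]
  calc _ ≤ (‖v‖ ^ 2 + ‖v + z‖ ^ 2) / (2 * ‖v‖) := by gcongr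
    _ = _ := by rw [h]; field_simp; ring

/-- The distance to the ball `B_R(y)`, raised to the power `α`. -/
noncomputable def powDist (y : Rn n) (R α : ℝ) (x : Rn n) : ℝ := (max (‖x - y‖ - R) 0) ^ α

theorem powDist_nonneg (y : Rn n) (R α : ℝ) (x : Rn n) : 0 ≤ powDist y R α x := by
  unfold powDist; positivity

theorem powDist_eq_zero {y x : Rn n} {R α : ℝ} (hα : α ≠ 0) (h : ‖x - y‖ ≤ R) :
    powDist y R α x = 0 := by
  rw [powDist, max_eq_right (by linarith), Real.zero_rpow hα]

theorem powDist_of_le {y x : Rn n} {R α : ℝ} (h : R ≤ ‖x - y‖) :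
    powDist y R α x = (‖x - y‖ - R) ^ α := by
  rw [powDist, max_eq_left (by linarith)]

theorem continuous_powDist (y : Rn n) (R : ℝ) {α : ℝ} (hα : 0 ≤ α) :
    Continuous (powDist y R α) := by
  unfold powDist
  exact Continuous.rpow_const (by fun_prop) fun _ => Or.inr hα

/-- The gradient of `powDist` outside the ball, as a linear form. -/
noncomputable def powDistGrad (y : Rn n) (R α : ℝ) (x : Rn n) : Rn n →L[ℝ] ℝ :=
  (α * ((‖x - y‖ - R) ^ α / (‖x - y‖ - R))) • innerSL ℝ (‖x - y‖⁻¹ • (x - y))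

theorem powDistGrad_apply (y : Rn n) (R α : ℝ) (x z : Rn n) :
    powDistGrad y R α x z =
      α * ((‖x - y‖ - R) ^ α / (‖x - y‖ - R)) * inner ℝ (‖x - y‖⁻¹ • (x - y)) z := by
  simp only [powDistGrad, _root_.smul_apply, innerSL_apply_apply, smul_eq_mul]

theorem norm_powDistGrad_le {y x : Rn n} {R α : ℝ} (hα : 0 ≤ α) (hR : 0 < R)
    (hx : R < ‖x - y‖) :
    ‖powDistGrad y R α x‖ ≤ α * ((‖x - y‖ - R) ^ α / (‖x - y‖ - R)) := by
  have hd : 0 < ‖x - y‖ - R := by linarith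
  have : ‖(‖x - y‖⁻¹ • (x - y))‖ = 1 := by
    rw [norm_smul, norm_inv, norm_norm, inv_mul_cancel₀ (by linarith)]
  rw [powDistGrad, norm_smul, innerSL_apply_norm, this, mul_one, Real.norm_of_nonneg]
  positivity

theorem powDist_growth {y x z : Rn n} {R α b : ℝ} (hα : 0 < α) (hαb : α ≤ b) (hb1 : b ≤ 1)
    (hx : R < ‖x - y‖) :
    powDist y R α (x + z) - powDist y R α x ≤
      α / b * ((‖x - y‖ - R) ^ α * (‖z‖ / (‖x - y‖ - R)) ^ b) := by
  refine le_trans ?_ (rpow_growth hα hαb hb1 (sub_pos.2 hx) (norm_nonneg z))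
  rw [powDist_of_le hx.le]
  refine sub_le_sub_right (Real.rpow_le_rpow (le_max_right _ _) (max_le ?_ ?_) hα.le) _
  · have : x + z - y = (x - y) + z := by abel
    rw [this]
    linarith [norm_add_le (x - y) z]
  · linarith [norm_nonneg z]

/-- The tangent line bounds the concave power from above, and the norm is expanded to second order.
The condition on `‖z‖` keeps `x + z` outside the open ball, where no truncation at zero occurs. -/
theorem powDist_second_order {y x z : Rn n} {R α : ℝ} (hα : 0 ≤ α) (hα1 : α ≤ 1) (hR : 0 < R)
    (hx : R < ‖x - y‖) (hz : ‖z‖ ≤ ‖x - y‖ - R) :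
    powDist y R α (x + z) - powDist y R α x - powDistGrad y R α x z ≤
      α * ((‖x - y‖ - R) ^ α * (‖z‖ / (‖x - y‖ - R)) ^ 2) := by
  set d := ‖x - y‖ - R with hd_def
  have hd : 0 < d := sub_pos.2 hx
  have e : x + z - y = (x - y) + z := by abel
  have h1 : R ≤ ‖x + z - y‖ := by
    rw [e]
    linarith [norm_sub_le_norm_add (x - y) z]
  have h2 := rpow_le_tangent hα hα1 hd (sub_nonneg.2 h1)
  have h3 := norm_add_le_second_order (v := x - y) (z := z) (by linarith)
  rw [powDist_of_le h1, powDist_of_le hx.le, powDistGrad_apply, ← hd_def]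
  rw [← e] at h3
  have hc : 0 ≤ α * (d ^ α / d) := by positivity
  have h4 : ‖x + z - y‖ - R - d ≤
      inner ℝ (‖x - y‖⁻¹ • (x - y)) z + ‖z‖ ^ 2 / d := by
    have : ‖z‖ ^ 2 / (2 * ‖x - y‖) ≤ ‖z‖ ^ 2 / d := by
      gcongr
      linarith
    linarith
  have h5 := mul_le_mul_of_nonneg_left h4 hc
  have h6 : α * (d ^ α * (‖z‖ / d) ^ 2) = α * (d ^ α / d) * (‖z‖ ^ 2 / d) := by
    field_simp
  rw [h6]
  linarith

/-- With `d = ‖x - y‖ - R`, a jump in this cap moves inward by at least `4d`, while `‖z‖² ≤ 4Rd`.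
Hence `‖x + z - y‖² ≤ (R + d)² - 8d(R + d) + 4Rd ≤ R²`. -/
theorem norm_le_of_mem_cap {y x z : Rn n} {R θ : ℝ} (hθ : 0 < θ) (hR : 0 < R)
    (hx : R < ‖x - y‖) (hdR : ‖x - y‖ - R ≤ θ ^ 2 / 16 * R)
    (hz : z ∈ cap (‖x - y‖⁻¹ • (x - y)) θ (4 * (‖x - y‖ - R) / θ)) :
    ‖x + z - y‖ ≤ R := by
  set d := ‖x - y‖ - R with hd_def
  have hd : 0 < d := sub_pos.2 hx
  have hv : ‖x - y‖ = R + d := by rw [hd_def]; ring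
  have e : x + z - y = (x - y) + z := by abel
  obtain ⟨hz1, hz2⟩ := hz
  have hz3 := (mem_annulus.1 hz1).2
  rw [real_inner_smul_left, mul_div_cancel₀ _ hθ.ne', inv_mul_le_iff₀ (by linarith), hv] at hz2
  have h : ‖x + z - y‖ ^ 2 = ‖x - y‖ ^ 2 + 2 * inner ℝ (x - y) z + ‖z‖ ^ 2 := by
    rw [e]; exact norm_add_sq_real _ _
  have hzsq : ‖z‖ ^ 2 ≤ 4 * R * d := by
    calc ‖z‖ ^ 2 ≤ (2 * (4 * d / θ)) ^ 2 := by gcongr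
      _ = 64 / θ ^ 2 * d * d := by field_simp; ring
      _ ≤ 64 / θ ^ 2 * (θ ^ 2 / 16 * R) * d := by gcongr
      _ = 4 * R * d := by field_simp; ring
  rw [hv] at h
  refine abs_le_of_sq_le_sq' ?_ hR.le |>.2
  nlinarith

/-! ### Pointwise and integrated bounds for compensated increments -/

/-- The compensator in `diffQuot`. -/
noncomputable def compensator (σ : ℝ) (l : Rn n →L[ℝ] ℝ) (z : Rn n) : ℝ :=
  open Classical in
  if σ < 1 then 0 else if σ = 1 then (if z ∈ ball (0 : Rn n) 1 then l z else 0) else l z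

theorem diffQuot_eq (σ : ℝ) (u : Rn n → ℝ) (x z : Rn n) :
    diffQuot σ u x z = u (x + z) - u x - compensator σ (fderiv ℝ u x) z := by
  unfold diffQuot compensator
  split_ifs <;> simp

/-- The integrability exponent of kernels of order `σ` near the origin. -/
noncomputable def nearExp (σ : ℝ) : ℝ := if σ < 1 then 1 else 2

/-- The integrability exponent of kernels of order `σ` near infinity. -/
noncomputable def farExp (σ : ℝ) : ℝ := if σ ≤ 1 then σ / 2 else 1

theorem lt_nearExp (hσ2 : σ < 2) : σ < nearExp σ := by
  unfold nearExp; split_ifs <;> linarith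

theorem nearExp_pos : 0 < nearExp σ := by
  unfold nearExp; split_ifs <;> norm_num

theorem farExp_lt (hσ0 : 0 < σ) : farExp σ < σ := by
  unfold farExp; split_ifs <;> linarith

theorem farExp_pos (hσ0 : 0 < σ) : 0 < farExp σ := by
  unfold farExp; split_ifs <;> linarith

theorem farExp_le_one : farExp σ ≤ 1 := by
  unfold farExp; split_ifs <;> linarith

open Classical in
/-- The profile `|z|^p` for `|z| < ρ` and `|z|^b` for `|z| ≥ ρ`, in units of `d`. -/
noncomputable def envelope (σ ρ d : ℝ) (z : Rn n) : ℝ :=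
  if z ∈ ball (0 : Rn n) ρ then (‖z‖ / d) ^ nearExp σ else (‖z‖ / d) ^ farExp σ

/-- Near the origin the first or second order expansion applies, according to `nearExp`. Away from
it the growth bound with exponent `farExp σ < σ` applies; that exponent is `1` for `σ > 1`, so that
it also absorbs the linear compensator. On the cap the barrier drops by its full value `d^α`. The
`ballGap` term trades, for `σ = 1`, the cut-off radius `1` for `ρ`. -/
theorem powDist_diff_le (hσ0 : 0 < σ) {y x z : Rn n} {R α θ ρ : ℝ}
    (hα : 0 < α) (hαb : α ≤ farExp σ) (hR : 0 < R) (hθ : 0 < θ) (hθ1 : θ ≤ 1)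
    (hx : R < ‖x - y‖) (hdR : ‖x - y‖ - R ≤ θ ^ 2 / 16 * R) (hρ : ρ ≤ ‖x - y‖ - R) :
    powDist y R α (x + z) - powDist y R α x - compensator σ (powDistGrad y R α x) z ≤
      α * (1 / farExp σ + 1) * ((‖x - y‖ - R) ^ α * envelope σ ρ (‖x - y‖ - R) z)
      - (‖x - y‖ - R) ^ α *
          (cap (‖x - y‖⁻¹ • (x - y)) θ (4 * (‖x - y‖ - R) / θ)).indicator 1 z
      - (if σ = 1 then ballGap n ρ z * powDistGrad y R α x z else 0) := by
  classical
  have hbp := farExp_pos hσ0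
  have hb1 := farExp_le_one (σ := σ)
  have hα1 : α ≤ 1 := hαb.trans hb1
  have G1 := powDist_growth (z := z) hα hα1 le_rfl hx
  have Gb := powDist_growth (z := z) hα hαb hb1 hx
  have hl := (powDistGrad y R α x).le_opNorm z
  have hlb := norm_powDistGrad_le hα.le hR hx
  have hx0 := powDist_of_le (α := α) hx.le
  have S2 := powDist_second_order (z := z) hα.le hα1 hR hx
  have hcap := norm_le_of_mem_cap (z := z) hθ hR hx hdR
  set d := ‖x - y‖ - R with hd_def
  have hd : 0 < d := sub_pos.2 hx
  set l := powDistGrad y R α x with hl_def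
  have hinv : 1 ≤ 1 / farExp σ + 1 := by linarith [one_div_pos.2 hbp]
  have hαd : 0 ≤ α * d ^ α := by positivity
  by_cases hz : ‖z‖ < ρ
  · have hzb : z ∈ ball (0 : Rn n) ρ := by simpa using hz
    -- Points of the cap satisfy `‖z‖ ≥ 4d/θ ≥ 4d`, whereas `‖z‖ < ρ ≤ d` here.
    have hnc : z ∉ cap (‖x - y‖⁻¹ • (x - y)) θ (4 * d / θ) := by
      intro h
      have h1 := (mem_annulus.1 h.1).1
      rw [div_le_iff₀ hθ] at h1
      nlinarith [norm_nonneg z]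
    rw [indicator_of_notMem hnc, mul_zero, sub_zero]
    have key : powDist y R α (x + z) - powDist y R α x - (if σ < 1 then 0 else l z) ≤
        α * d ^ α * envelope σ ρ d z := by
      rw [envelope, if_pos hzb, nearExp]
      split_ifs
      · rw [sub_zero, mul_assoc]
        simpa using G1
      · rw [mul_assoc]
        have := S2 (by linarith)
        exact_mod_cast this
    have henv : 0 ≤ envelope σ ρ d z := by
      rw [envelope]; split_ifs
      all_goals positivity
    have hmul : α * d ^ α * envelope σ ρ d z ≤
        α * (1 / farExp σ + 1) * (d ^ α * envelope σ ρ d z) := by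
      have := mul_le_mul_of_nonneg_left hinv (mul_nonneg hαd henv)
      linarith
    refine le_sub_iff_add_le.2 (le_trans ?_ (key.trans hmul))
    rcases lt_trichotomy σ 1 with h | h | h
    · simp [compensator, h, h.ne]
    · subst h
      have e1 : compensator 1 l z = if z ∈ ball (0 : Rn n) 1 then l z else 0 := by
        simp [compensator]
      rw [e1, if_pos rfl, ballGap, if_pos hzb, if_neg (lt_irrefl _)]
      split_ifs <;> linarith
    · simp [compensator, h.not_gt, h.ne']
  · have hzb : z ∉ ball (0 : Rn n) ρ := by simpa using hz
    have e0 : envelope σ ρ d z = (‖z‖ / d) ^ farExp σ := if_neg hzb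
    have hc : -(compensator σ l z) + (if σ = 1 then ballGap n ρ z * l z else 0) ≤
        α * (d ^ α * (‖z‖ / d) ^ farExp σ) := by
      rcases lt_trichotomy σ 1 with h | h | h
      · simp only [compensator, h, h.ne, if_true, if_false]
        simp only [neg_zero, add_zero]
        positivity
      · subst h
        have e1 : compensator 1 l z = if z ∈ ball (0 : Rn n) 1 then l z else 0 := by
          simp [compensator]
        have : 0 ≤ α * (d ^ α * (‖z‖ / d) ^ farExp 1) := by positivity
        rw [e1, if_pos rfl, ballGap, if_neg hzb]
        split_ifs <;> linarith
      · simp only [compensator, h.not_gt, h.ne', if_false, add_zero, farExp, h.not_ge, Real.rpow_one]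
        refine (neg_le_abs _).trans (hl.trans ?_)
        calc ‖l‖ * ‖z‖ ≤ α * (d ^ α / d) * ‖z‖ := by gcongr
          _ = _ := by ring
    have hmain : powDist y R α (x + z) - powDist y R α x + d ^ α *
        (cap (‖x - y‖⁻¹ • (x - y)) θ (4 * d / θ)).indicator 1 z ≤
        α / farExp σ * (d ^ α * (‖z‖ / d) ^ farExp σ) := by
      by_cases hzc : z ∈ cap (‖x - y‖⁻¹ • (x - y)) θ (4 * d / θ)
      · rw [indicator_of_mem hzc, powDist_eq_zero hα.ne' (hcap hzc), hx0]
        simp only [Pi.one_apply, mul_one, zero_sub, neg_add_cancel]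
        positivity
      · rwa [indicator_of_notMem hzc, mul_zero, add_zero]
    rw [e0]
    have : α * (1 / farExp σ + 1) * (d ^ α * (‖z‖ / d) ^ farExp σ) =
        α / farExp σ * (d ^ α * (‖z‖ / d) ^ farExp σ) + α * (d ^ α * (‖z‖ / d) ^ farExp σ) := by
      ring
    linarith

/-- The constant in the integral bound for `envelope`. -/
noncomputable def envelopeConst (σ Lam : ℝ) : ℝ :=
  momentConst σ Lam (nearExp σ) (1 / 2) + momentConst σ Lam (farExp σ) 2 * (1 / 2) ^ (farExp σ - σ)

theorem envelopeConst_nonneg (hσ0 : 0 < σ) (hσ2 : σ < 2) (hL : 0 ≤ (2 - σ) * Lam) :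
    0 ≤ envelopeConst σ Lam := by
  have h1 := momentConst_nonneg (σ := σ) hL (p := nearExp σ) (t := 1 / 2)
    (Real.rpow_lt_one (by norm_num) (by norm_num) (by linarith [lt_nearExp hσ2]))
  have h2 := momentConst_nonneg (σ := σ) hL (p := farExp σ) (t := 2)
    (Real.rpow_lt_one_of_one_lt_of_neg (by norm_num) (by linarith [farExp_lt hσ0]))
  unfold envelopeConst
  positivity

theorem envelope_mul_eq {ρ d : ℝ} (hd : 0 < d) (f : Rn n → ℝ) :
    (fun z => envelope σ ρ d z * f z) = fun z =>
      (ball (0 : Rn n) ρ).indicator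
        (fun z => (d ^ nearExp σ)⁻¹ * (‖z‖ ^ nearExp σ * f z)) z +
      ((ball (0 : Rn n) ρ)ᶜ).indicator
        (fun z => (d ^ farExp σ)⁻¹ * (‖z‖ ^ farExp σ * f z)) z := by
  ext z
  by_cases hz : z ∈ ball (0 : Rn n) ρ
  · rw [envelope, if_pos hz, indicator_of_mem hz, indicator_of_notMem (by simpa using hz),
      Real.div_rpow (norm_nonneg z) hd.le]
    ring
  · rw [envelope, if_neg hz, indicator_of_notMem hz, indicator_of_mem (by simpa using hz),
      Real.div_rpow (norm_nonneg z) hd.le]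
    ring

theorem envelope_moment (hK : IsKernel σ lam Lam mu K) (hσ0 : 0 < σ) (hσ2 : σ < 2)
    (hL : 0 ≤ (2 - σ) * Lam) {ρ d : ℝ} (hd : 0 < d) (hρ : d / 2 ≤ ρ) (hρd : ρ ≤ d) :
    Integrable (fun z => envelope σ ρ d z * K z) ∧
      ∫ z, envelope σ ρ d z * K z ≤ envelopeConst σ Lam * d ^ (-σ) := by
  have hρ0 : 0 < ρ := by linarith
  obtain ⟨n1, n2⟩ := near_moment hK hL nearExp_pos (lt_nearExp hσ2) hρ0
  obtain ⟨f1, f2⟩ := far_moment hK hL (farExp_pos hσ0).le (farExp_lt hσ0) hρ0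
  have hnc := momentConst_nonneg (σ := σ) hL (p := nearExp σ) (t := 1 / 2)
    (Real.rpow_lt_one (by norm_num) (by norm_num) (by linarith [lt_nearExp hσ2]))
  have hfc := momentConst_nonneg (σ := σ) hL (p := farExp σ) (t := 2)
    (Real.rpow_lt_one_of_one_lt_of_neg (by norm_num) (by linarith [farExp_lt hσ0]))
  have i1 := IntegrableOn.integrable_indicator (n1.const_mul (d ^ nearExp σ)⁻¹)
    measurableSet_ball
  have i2 := IntegrableOn.integrable_indicator (f1.const_mul (d ^ farExp σ)⁻¹)
    measurableSet_ball.compl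
  rw [envelope_mul_eq hd]
  refine ⟨i1.add i2, ?_⟩
  rw [integral_add i1 i2, integral_indicator measurableSet_ball,
    integral_indicator measurableSet_ball.compl, integral_const_mul, integral_const_mul,
    envelopeConst, add_mul]
  refine add_le_add ?_ ?_
  · calc (d ^ nearExp σ)⁻¹ * ∫ z in ball 0 ρ, ‖z‖ ^ nearExp σ * K z
        ≤ (d ^ nearExp σ)⁻¹ * (momentConst σ Lam (nearExp σ) (1 / 2) * ρ ^ (nearExp σ - σ)) := by
          gcongr
      _ ≤ (d ^ nearExp σ)⁻¹ * (momentConst σ Lam (nearExp σ) (1 / 2) * d ^ (nearExp σ - σ)) := by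
          have := lt_nearExp hσ2
          gcongr
      _ = _ := by
          rw [Real.rpow_sub hd, Real.rpow_neg hd.le]
          field_simp
  · calc (d ^ farExp σ)⁻¹ * ∫ z in (ball 0 ρ)ᶜ, ‖z‖ ^ farExp σ * K z
        ≤ (d ^ farExp σ)⁻¹ * (momentConst σ Lam (farExp σ) 2 * ρ ^ (farExp σ - σ)) := by
          gcongr
      _ ≤ (d ^ farExp σ)⁻¹ * (momentConst σ Lam (farExp σ) 2 * (1 / 2 * d) ^ (farExp σ - σ)) := by
          have := Real.rpow_le_rpow_of_nonpos (x := 1 / 2 * d) (y := ρ) (z := farExp σ - σ)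
            (by positivity) (by linarith) (by linarith [farExp_lt hσ0])
          gcongr
      _ = _ := by
          rw [Real.mul_rpow (by norm_num) hd.le, Real.rpow_sub hd, Real.rpow_neg hd.le]
          field_simp

/-! ### Integrability of compensated increments -/

theorem exists_second_order_bound {w : Rn n → ℝ} {x : Rn n} (hw : ContDiffAt ℝ 2 w x) :
    ∃ η C : ℝ, 0 < η ∧ η ≤ 1 ∧ 0 ≤ C ∧ ∀ z : Rn n, ‖z‖ < η →
      |w (x + z) - w x - fderiv ℝ w x z| ≤ C * ‖z‖ ^ 2 := by
  have h1 : ContDiffAt ℝ 1 (fderiv ℝ w) x := hw.fderiv_right (by norm_num)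
  obtain ⟨C, t, ht, hlip⟩ := h1.exists_lipschitzOnWith
  have hdiff : ∀ᶠ y in 𝓝 x, DifferentiableAt ℝ w y :=
    (hw.eventually (by simp)).mono fun y hy => hy.differentiableAt (by norm_num)
  obtain ⟨η, hη, hball⟩ := Metric.eventually_nhds_iff_ball.1 (hdiff.and ht)
  refine ⟨min η 1, C, by positivity, min_le_right _ _, C.2, fun z hz => ?_⟩
  have hz' : ‖z‖ < η := hz.trans_le (min_le_left _ _)
  have hsub : closedBall x ‖z‖ ⊆ ball x η := closedBall_subset_ball hz'
  have := (convex_closedBall x ‖z‖).norm_image_sub_le_of_norm_hasFDerivWithin_le' (f := w)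
    (f' := fderiv ℝ w) (φ := fderiv ℝ w x) (C := C * ‖z‖) (x := x) (y := x + z)
    (fun y hy => (hball y (hsub hy)).1.hasFDerivAt.hasFDerivWithinAt)
    (fun y hy => by
      refine (hlip.norm_sub_le (hball y (hsub hy)).2 (mem_of_mem_nhds ht)).trans ?_
      gcongr
      exact mem_closedBall_iff_norm.1 hy)
    (mem_closedBall_self (norm_nonneg z)) (by simp)
  rw [add_sub_cancel_left, Real.norm_eq_abs] at this
  rw [pow_two, ← mul_assoc]
  exact this

theorem abs_compensator_le (l : Rn n →L[ℝ] ℝ) {η : ℝ} (hη : 0 < η) (hη1 : η ≤ 1) {z : Rn n}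
    (hz : η ≤ ‖z‖) : |compensator σ l z| ≤ ‖l‖ * (‖z‖ / η) ^ farExp σ := by
  have hl : |l z| ≤ ‖l‖ * ‖z‖ := l.le_opNorm z
  have h1 : 1 ≤ ‖z‖ / η := (one_le_div hη).2 hz
  unfold compensator
  split_ifs with h h' h''
  · rw [abs_zero]; positivity
  · refine hl.trans ?_
    have h2 : ‖z‖ < 1 := by simpa using h''
    have h3 : 1 ≤ (‖z‖ / η) ^ farExp σ := Real.one_le_rpow h1 (farExp_pos (by linarith)).le
    gcongr
    linarith
  · rw [abs_zero]; positivity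
  · have : farExp σ = 1 := by
      rw [farExp, if_neg fun hle => h (lt_of_le_of_ne hle h')]
    rw [this, Real.rpow_one]
    refine hl.trans ?_
    gcongr
    rw [le_div_iff₀ hη]
    exact mul_le_of_le_one_right (norm_nonneg z) hη1

theorem measurable_diffQuot {w : Rn n → ℝ} (hw : Measurable w) (σ : ℝ) (x : Rn n) :
    Measurable (diffQuot σ w x) := by
  have h1 : Measurable fun z => w (x + z) - w x := (hw.comp (measurable_const_add x)).sub_const _
  have h2 : Measurable fun z => fderiv ℝ w x z := (fderiv ℝ w x).continuous.measurable
  unfold diffQuot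
  split_ifs
  · exact h1
  · exact h1.sub (h2.ite measurableSet_ball measurable_const)
  · exact h1.sub h2

/-- Integrals can be compared only once this is known, since a non-integrable function has integral
`0` by convention. The increments are dominated by a multiple of the envelope at the scale `η` of
the Taylor bound. -/
theorem integrable_diffQuot (hK : IsKernel σ lam Lam mu K) (hσ0 : 0 < σ) (hσ2 : σ < 2)
    (hL : 0 ≤ (2 - σ) * Lam) {w : Rn n → ℝ} (hm : Measurable w) (hb : BoundedFun w) {x : Rn n}
    (hw : ContDiffAt ℝ 2 w x) : Integrable fun z => diffQuot σ w x z * K z := by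
  obtain ⟨η, C, hη, hη1, hC, hbd⟩ := exists_second_order_bound hw
  obtain ⟨M, hM⟩ := hb
  have hM0 : 0 ≤ M := (abs_nonneg _).trans (hM 0)
  set l := fderiv ℝ w x with hl_def
  have hpt : ∀ z, |diffQuot σ w x z| ≤ (C + ‖l‖ + 2 * M) * envelope σ η η z := by
    intro z
    rw [diffQuot_eq, ← hl_def]
    by_cases hz : ‖z‖ < η
    · have hzb : z ∈ ball (0 : Rn n) η := by simpa using hz
      have h2 := hbd z hz
      have hl : |l z| ≤ ‖l‖ * ‖z‖ := l.le_opNorm z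
      have hz1 : ‖z‖ ≤ 1 := by linarith
      have hdiv : ‖z‖ ≤ ‖z‖ / η := by
        rw [le_div_iff₀ hη]
        exact mul_le_of_le_one_right (norm_nonneg z) hη1
      have hnn := norm_nonneg z
      have hln := norm_nonneg l
      rw [envelope, if_pos hzb, nearExp]
      by_cases hσ : σ < 1
      · have e : compensator σ l z = 0 := by simp [compensator, hσ]
        rw [e, sub_zero, if_pos hσ, Real.rpow_one]
        have : |w (x + z) - w x| ≤ C * ‖z‖ ^ 2 + ‖l‖ * ‖z‖ := by
          calc |w (x + z) - w x| = |(w (x + z) - w x - l z) + l z| := by rw [sub_add_cancel]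
            _ ≤ _ := (abs_add_le _ _).trans (add_le_add h2 hl)
        calc |w (x + z) - w x| ≤ C * ‖z‖ ^ 2 + ‖l‖ * ‖z‖ := this
          _ ≤ C * ‖z‖ + ‖l‖ * ‖z‖ + 2 * M * ‖z‖ := by
              have : ‖z‖ ^ 2 ≤ ‖z‖ := by nlinarith
              have := mul_le_mul_of_nonneg_left this hC
              have : 0 ≤ 2 * M * ‖z‖ := by positivity
              linarith
          _ = (C + ‖l‖ + 2 * M) * ‖z‖ := by ring
          _ ≤ _ := by gcongr
      · have e : compensator σ l z = l z := by
          have : ‖z‖ < 1 := by linarith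
          simp [compensator, hσ, this]
        rw [e, if_neg hσ]
        refine h2.trans ?_
        have e2 : (‖z‖ / η) ^ (2 : ℝ) = (‖z‖ / η) ^ 2 := by exact_mod_cast Real.rpow_natCast _ 2
        rw [e2]
        gcongr
        linarith
    · have hzb : z ∉ ball (0 : Rn n) η := by simpa using hz
      have h1 : 1 ≤ (‖z‖ / η) ^ farExp σ :=
        Real.one_le_rpow ((one_le_div hη).2 (not_lt.1 hz)) (farExp_pos hσ0).le
      rw [envelope, if_neg hzb]
      have h2 := abs_compensator_le (σ := σ) l hη hη1 (not_lt.1 hz)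
      have h3 : |w (x + z) - w x| ≤ 2 * M := (abs_sub _ _).trans (by linarith [hM (x + z), hM x])
      refine (abs_sub _ _).trans ((add_le_add h3 h2).trans ?_)
      nlinarith
  refine Integrable.mono'
    ((envelope_moment hK hσ0 hσ2 hL hη (half_le_self hη.le) le_rfl).1.const_mul
      (C + ‖l‖ + 2 * M)) ((measurable_diffQuot hm σ x).mul hK.measurable).aestronglyMeasurable ?_
  refine Filter.Eventually.of_forall fun z => ?_
  rw [Real.norm_eq_abs, abs_mul, abs_of_nonneg (hK.nonneg z), ← mul_assoc]
  exact mul_le_mul_of_nonneg_right (hpt z) (hK.nonneg z)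

/-! ### Strict supersolution property of the barriers -/

/-- If the increments of `w` at `x` are dominated by those of a multiple of `powDist`, then
`levyOp σ K w x` is negative for small `α`. -/
theorem levyOp_le_of_increment_le (hσ0 : 0 < σ) (hσ2 : σ < 2)
    (hL : 0 ≤ (2 - σ) * Lam) (hK : IsKernel σ lam Lam mu K)
    {θ c : ℝ} (hθ : 0 < θ) (hθ1 : θ ≤ 1)
    (hcap : ∀ N : Rn n, ‖N‖ = 1 → ∀ δ : ℝ, 0 < δ → c * δ ^ (-σ) ≤ ∫ z in cap N θ δ, K z)
    {w : Rn n → ℝ} (hm : Measurable w) (hb : BoundedFun w) {x y : Rn n} {R α A : ℝ}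
    (hα : 0 < α) (hαb : α ≤ farExp σ) (hR : 0 < R)
    (hx : R < ‖x - y‖) (hdR : ‖x - y‖ - R ≤ θ ^ 2 / 16 * R) (hA : 0 ≤ A)
    (hw : ContDiffAt ℝ 2 w x) (hgrad : fderiv ℝ w x = A • powDistGrad y R α x)
    (hinc : ∀ z, w (x + z) - w x ≤ A * (powDist y R α (x + z) - powDist y R α x)) :
    levyOp σ K w x ≤ A * ((‖x - y‖ - R) ^ (α - σ) *
      (α * ((1 / farExp σ + 1) * envelopeConst σ Lam) - c * (4 / θ) ^ (-σ))) := by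
  set d := ‖x - y‖ - R with hd_def
  have hd : 0 < d := sub_pos.2 hx
  set N := ‖x - y‖⁻¹ • (x - y) with hN_def
  set l := powDistGrad y R α x with hl_def
  have hN : ‖N‖ = 1 := by
    rw [hN_def, norm_smul, norm_inv, norm_norm, inv_mul_cancel₀ (by linarith)]
  -- The radius `2 ^ k` lies in `(d/2, d]`: comparable to `d`, as the envelope requires, and dyadic,
  -- as the vanishing of the `ballGap` moment requires.
  obtain ⟨k, hk1, hk2⟩ := exists_mem_Ico_zpow (x := d) (y := (2 : ℝ)) hd (by norm_num)
  rw [zpow_add₀ (by norm_num), zpow_one] at hk2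
  obtain ⟨e1, e2⟩ := envelope_moment hK hσ0 hσ2 hL hd (ρ := 2 ^ k) (by linarith) hk1
  have hδ : 0 < 4 * d / θ := by positivity
  have c1 : Integrable ((cap N θ (4 * d / θ)).indicator K) :=
    ((integrableOn_annulus hK hδ).mono_set fun z hz => hz.1).integrable_indicator
      (measurableSet_cap _ _ _)
  have c2 : ∫ z, (cap N θ (4 * d / θ)).indicator K z = ∫ z in cap N θ (4 * d / θ), K z :=
    integral_indicator (measurableSet_cap _ _ _)
  have gap : Integrable (fun z => if σ = 1 then ballGap n (2 ^ k) z * (l z * K z) else 0) ∧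
      ∫ z, (if σ = 1 then ballGap n (2 ^ k) z * (l z * K z) else 0) = 0 := by
    by_cases h : σ = 1
    · subst h
      simpa using ballGap_moment hK k l
    · simp [h]
  have hpt : ∀ z, diffQuot σ w x z * K z ≤
      A * (α * (1 / farExp σ + 1) * d ^ α * (envelope σ (2 ^ k) d z * K z)
        - d ^ α * (cap N θ (4 * d / θ)).indicator K z
        - (if σ = 1 then ballGap n (2 ^ k) z * (l z * K z) else 0)) := by
    intro z
    have hcomp : compensator σ (A • l) z = A * compensator σ l z := by
      unfold compensator
      split_ifs <;> simp
    have h1 := powDist_diff_le (z := z) hσ0 hα hαb hR hθ hθ1 hx hdR hk1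
    have h2 : diffQuot σ w x z ≤ A * (powDist y R α (x + z) - powDist y R α x
        - compensator σ l z) := by
      rw [diffQuot_eq, hgrad, hcomp]
      linarith [hinc z]
    refine (mul_le_mul_of_nonneg_right (h2.trans (mul_le_mul_of_nonneg_left h1 hA))
      (hK.nonneg z)).trans_eq ?_
    have h3 : (cap N θ (4 * d / θ)).indicator K z =
        (cap N θ (4 * d / θ)).indicator 1 z * K z := by
      by_cases hz : z ∈ cap N θ (4 * d / θ) <;> simp [hz]
    rw [h3]
    split_ifs <;> ring
  have i1 := e1.const_mul (α * (1 / farExp σ + 1) * d ^ α)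
  have i2 := c1.const_mul (d ^ α)
  have hbp := farExp_pos hσ0
  calc levyOp σ K w x ≤ _ := integral_mono (integrable_diffQuot hK hσ0 hσ2 hL hm hb hw)
        (((i1.sub i2).sub gap.1).const_mul A) hpt
    _ = A * (α * (1 / farExp σ + 1) * d ^ α * (∫ z, envelope σ (2 ^ k) d z * K z)
        - d ^ α * ∫ z in cap N θ (4 * d / θ), K z) := by
        rw [integral_const_mul, integral_sub' (i1.sub i2) gap.1, integral_sub' i1 i2,
          integral_const_mul, integral_const_mul, c2, gap.2, sub_zero]
    _ ≤ A * (α * (1 / farExp σ + 1) * d ^ α * (envelopeConst σ Lam * d ^ (-σ))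
        - d ^ α * (c * (4 * d / θ) ^ (-σ))) := by
        have := hcap N hN _ hδ
        gcongr
    _ = _ := by
        rw [mul_div_right_comm 4 d θ, Real.mul_rpow (by positivity) hd.le, sub_eq_add_neg α σ,
          Real.rpow_add hd]
        ring

theorem powDist_eventuallyEq {y x : Rn n} {R α : ℝ} (hx : R < ‖x - y‖) :
    powDist y R α =ᶠ[𝓝 x] fun x => (‖x - y‖ - R) ^ α := by
  have : ∀ᶠ x' in 𝓝 x, R < ‖x' - y‖ :=
    (isOpen_lt continuous_const (by fun_prop : Continuous fun x' : Rn n => ‖x' - y‖)).mem_nhds hx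
  exact this.mono fun x' hx' => powDist_of_le hx'.le

theorem contDiffAt_powDist {y x : Rn n} {R α : ℝ} (hR : 0 < R) (hx : R < ‖x - y‖) :
    ContDiffAt ℝ 2 (powDist y R α) x := by
  refine ContDiffAt.congr_of_eventuallyEq ?_ (powDist_eventuallyEq hx)
  refine ContDiffAt.rpow_const_of_ne (ContDiffAt.sub ?_ contDiffAt_const) (by linarith)
  exact (contDiffAt_id.sub contDiffAt_const).norm ℝ (norm_pos_iff.1 (hR.trans hx))

theorem hasFDerivAt_powDist {y x : Rn n} {R α : ℝ} (hR : 0 < R) (hx : R < ‖x - y‖) :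
    HasFDerivAt (powDist y R α) (powDistGrad y R α x) x := by
  refine HasFDerivAt.congr_of_eventuallyEq ?_ (powDist_eventuallyEq hx)
  have hv : 0 < ‖x - y‖ := hR.trans hx
  have h1 : HasFDerivAt (fun x => ‖x - y‖ ^ 2) (2 • innerSL ℝ (x - y)) x := by
    simpa using ((hasFDerivAt_id x).sub_const y).norm_sq
  have h2 : HasFDerivAt (fun x => ‖x - y‖) (innerSL ℝ (‖x - y‖⁻¹ • (x - y))) x := by
    have h := h1.sqrt (by positivity)
    simp only [Real.sqrt_sq (norm_nonneg _)] at h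
    refine h.congr_fderiv ?_
    ext z
    simp only [innerSL_apply_apply, _root_.smul_apply, real_inner_smul_left, nsmul_eq_mul,
      smul_eq_mul, Nat.cast_ofNat]
    field_simp
  have h3 := (h2.sub_const R).rpow_const (p := α) (Or.inl (by linarith))
  refine h3.congr_fderiv ?_
  rw [powDistGrad, Real.rpow_sub_one (by linarith)]

/-- A multiple of `powDist` plus a constant, truncated from above at height `T`. -/
noncomputable def barrier (y : Rn n) (R α A c T : ℝ) (x : Rn n) : ℝ :=
  min (c + A * powDist y R α x) T

theorem continuous_barrier (y : Rn n) (R A c T : ℝ) {α : ℝ} (hα : 0 ≤ α) :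
    Continuous (barrier y R α A c T) :=
  (continuous_const.add (continuous_const.mul (continuous_powDist y R hα))).min continuous_const

theorem boundedFun_barrier (y : Rn n) (R α c T : ℝ) {A : ℝ} (hA : 0 ≤ A) :
    BoundedFun (barrier y R α A c T) := by
  refine ⟨|c| + |T|, fun x => ?_⟩
  have h1 : 0 ≤ A * powDist y R α x := mul_nonneg hA (powDist_nonneg _ _ _ _)
  rw [barrier, abs_le]
  constructor
  · refine le_min ?_ ?_
    · linarith [neg_abs_le c, abs_nonneg T]
    · linarith [neg_abs_le T, abs_nonneg c]
  · exact (min_le_right _ _).trans (by linarith [le_abs_self T, abs_nonneg c])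

theorem barrier_eventuallyEq {y x : Rn n} {R α A c T : ℝ} (hα : 0 ≤ α)
    (hT : c + A * powDist y R α x < T) :
    barrier y R α A c T =ᶠ[𝓝 x] fun x => c + A * powDist y R α x := by
  have : ∀ᶠ x' in 𝓝 x, c + A * powDist y R α x' < T :=
    (isOpen_lt (continuous_const.add (continuous_const.mul (continuous_powDist y R hα)))
      continuous_const).mem_nhds hT
  exact this.mono fun x' hx' => min_eq_left hx'.le

theorem contDiffAt_barrier {y x : Rn n} {R α A c T : ℝ} (hα : 0 ≤ α) (hR : 0 < R)
    (hx : R < ‖x - y‖) (hT : c + A * powDist y R α x < T) :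
    ContDiffAt ℝ 2 (barrier y R α A c T) x :=
  (contDiffAt_const.add (contDiffAt_const.mul (contDiffAt_powDist hR hx))).congr_of_eventuallyEq
    (barrier_eventuallyEq hα hT)

theorem fderiv_barrier {y x : Rn n} {R α A c T : ℝ} (hα : 0 ≤ α) (hR : 0 < R)
    (hx : R < ‖x - y‖) (hT : c + A * powDist y R α x < T) :
    fderiv ℝ (barrier y R α A c T) x = A • powDistGrad y R α x := by
  rw [(barrier_eventuallyEq hα hT).fderiv_eq]
  exact (((hasFDerivAt_powDist hR hx).const_mul A).const_add c).fderiv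

/-- Exterior barriers: with `α` small, `barrier` is a strict supersolution close to its ball. -/
theorem exists_barrier_constants (hn : 1 ≤ n) (hσ0 : 0 < σ) (hσ2 : σ < 2) (hlam : 0 < lam)
    (hmu : 0 < mu) (hL : 0 ≤ (2 - σ) * Lam) {C₀ : ℝ} (hC : 0 ≤ C₀) (hC' : σ < 1 → C₀ = 0) :
    ∃ κ : ℝ, 0 < κ ∧ ∀ D : ℝ, 0 < D → ∃ α c : ℝ, 0 < α ∧ 0 < c ∧
      ∀ (y x : Rn n) (R A a T : ℝ), 0 < R → R < ‖x - y‖ → ‖x - y‖ - R ≤ κ * R →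
        ‖x - y‖ - R ≤ D → 0 ≤ A → a + A * powDist y R α x < T →
        ∀ K : Rn n → ℝ, IsKernel σ lam Lam mu K →
          levyOp σ K (barrier y R α A a T) x + C₀ * ‖fderiv ℝ (barrier y R α A a T) x‖
            ≤ -(A * c) := by
  obtain ⟨θ, c, hθ, hθ1, hc, hcap⟩ := exists_cap_mass (σ := σ) hn hσ2 hlam hmu
  refine ⟨θ ^ 2 / 16, by positivity, fun D hD => ?_⟩
  have hbp := farExp_pos hσ0
  have hE := envelopeConst_nonneg hσ0 hσ2 hL
  set g := c * (4 / θ) ^ (-σ) with hg_def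
  have hg : 0 < g := by positivity
  -- `α * Q` collects all positive contributions, gradient term included; `α` is chosen so that they
  -- use up at most half of the gain `g`.
  set Q := (1 / farExp σ + 1) * envelopeConst σ Lam + C₀ * D ^ (σ - 1) with hQ_def
  have hQ : 0 ≤ Q := by positivity
  set α := min (farExp σ) (g / 2 / (Q + 1)) with hα_def
  have hα : 0 < α := lt_min hbp (by positivity)
  have hαb : α ≤ farExp σ := min_le_left _ _
  have hαQ : α * Q ≤ g / 2 := by
    have h : α * (Q + 1) ≤ g / 2 := (le_div_iff₀ (by linarith)).1 (min_le_right _ _)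
    nlinarith
  refine ⟨α, D ^ (α - σ) * (g / 2), hα, by positivity, ?_⟩
  intro y x R A a T hR hx hdR hdD hA hT K hK
  have hgrad := fderiv_barrier hα.le hR hx hT
  -- The truncation is inactive at `x` and lowers the values elsewhere, so it only decreases
  -- increments.
  have hinc : ∀ z, barrier y R α A a T (x + z) - barrier y R α A a T x ≤
      A * (powDist y R α (x + z) - powDist y R α x) := fun z => by
    have h1 : barrier y R α A a T x = a + A * powDist y R α x := min_eq_left hT.le
    have h2 : barrier y R α A a T (x + z) ≤ a + A * powDist y R α (x + z) := min_le_left _ _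
    rw [h1]
    linarith
  have main := levyOp_le_of_increment_le hσ0 hσ2 hL hK hθ hθ1 (hcap Lam K hK)
    (continuous_barrier y R A a T hα.le).measurable (boundedFun_barrier y R α a T hA) hα hαb hR hx
    hdR hA (contDiffAt_barrier hα.le hR hx hT) hgrad hinc
  have hng := norm_powDistGrad_le hα.le hR hx
  set d := ‖x - y‖ - R with hd_def
  have hd : 0 < d := sub_pos.2 hx
  have hgr : C₀ * ‖fderiv ℝ (barrier y R α A a T) x‖ ≤
      A * (d ^ (α - σ) * (α * (C₀ * D ^ (σ - 1)))) := by
    -- The gradient is of order `d^(α-1) = d^(α-σ) d^(σ-1)`. The last factor is bounded by `D^(σ-1)`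
    -- only for `σ ≥ 1`; this is where `C₀ = 0` for `σ < 1` is needed.
    by_cases hσ1 : σ < 1
    · rw [hC' hσ1]
      simp
    · have hDd : d ^ (σ - 1) ≤ D ^ (σ - 1) := Real.rpow_le_rpow hd.le hdD (by linarith)
      have e : d ^ α / d = d ^ (α - σ) * d ^ (σ - 1) := by
        rw [← Real.rpow_add hd, ← Real.rpow_sub_one hd.ne']
        congr 1
        ring
      rw [hgrad, norm_smul, Real.norm_of_nonneg hA]
      calc C₀ * (A * ‖powDistGrad y R α x‖) ≤ C₀ * (A * (α * (d ^ α / d))) := by gcongr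
        _ = A * (d ^ (α - σ) * (α * (C₀ * d ^ (σ - 1)))) := by rw [e]; ring
        _ ≤ _ := by gcongr
  have hdσ : D ^ (α - σ) ≤ d ^ (α - σ) :=
    Real.rpow_le_rpow_of_nonpos hd hdD (by linarith [farExp_lt hσ0])
  have hsum : α * ((1 / farExp σ + 1) * envelopeConst σ Lam) - g + α * (C₀ * D ^ (σ - 1)) ≤
      -(g / 2) := by
    have : α * Q = α * ((1 / farExp σ + 1) * envelopeConst σ Lam) + α * (C₀ * D ^ (σ - 1)) := by
      rw [hQ_def]; ring
    linarith
  calc levyOp σ K (barrier y R α A a T) x + C₀ * ‖fderiv ℝ (barrier y R α A a T) x‖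
      ≤ A * (d ^ (α - σ) * (α * ((1 / farExp σ + 1) * envelopeConst σ Lam) - g)) +
        A * (d ^ (α - σ) * (α * (C₀ * D ^ (σ - 1)))) := add_le_add main hgr
    _ = A * (d ^ (α - σ) * (α * ((1 / farExp σ + 1) * envelopeConst σ Lam) - g +
          α * (C₀ * D ^ (σ - 1)))) := by ring
    _ ≤ A * (d ^ (α - σ) * -(g / 2)) := by gcongr
    _ = -(A * (d ^ (α - σ) * (g / 2))) := by ring
    _ ≤ _ := by gcongr

/-! ### From linear bounds to the nonlinear operator -/

variable {Ω : Set (Rn n)} {I : NonlocalOperator n}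

theorem exists_admissible {w : Rn n → ℝ} (hc : Continuous w) (hb : BoundedFun w) {x : Rn n}
    (hw : ContDiffAt ℝ 2 w x) : ∃ δ : ℝ, 0 < δ ∧ Admissible x δ w := by
  obtain ⟨δ, hδ, h⟩ := Metric.eventually_nhds_iff_ball.1 (hw.eventually (by simp))
  obtain ⟨C, hC⟩ := hb
  exact ⟨δ, hδ, fun y hy => (h y hy).contDiffWithinAt,
    memLp_top_of_bound hc.aestronglyMeasurable C (Filter.Eventually.of_forall hC)⟩

theorem admissible_of_contDiff {φ : Rn n → ℝ} (hφ : ContDiff ℝ 2 φ) (hb : BoundedFun φ) (x : Rn n)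
    (δ : ℝ) : Admissible x δ φ := by
  obtain ⟨C, hC⟩ := hb
  exact ⟨hφ.contDiffOn, memLp_top_of_bound hφ.continuous.aestronglyMeasurable C
    (Filter.Eventually.of_forall hC)⟩

/-- Only real lower bounds of the extended-real infimum are used, so an empty class of kernels needs
no separate treatment. -/
theorem le_extremalInf {u : Rn n → ℝ} {x : Rn n} {v : ℝ}
    (h : ∀ K, IsKernel σ lam Lam mu K → v ≤ levyOp σ K u x) :
    (v : EReal) ≤ extremalInf σ lam Lam mu u x :=
  le_iInf₂ fun K hK => EReal.coe_le_coe_iff.2 (h K hK)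

theorem real_le_of_ereal_le {e : EReal} {v a b : ℝ} (hv : (v : EReal) ≤ e)
    (h : e - (a : EReal) ≤ (b : EReal)) : v - a ≤ b := by
  have : ((v - a : ℝ) : EReal) ≤ (b : EReal) := by
    rw [EReal.coe_sub]
    exact (EReal.sub_le_sub hv le_rfl).trans h
  exact EReal.coe_le_coe_iff.1 this

theorem diffQuot_neg (σ : ℝ) (u : Rn n → ℝ) (x z : Rn n) :
    diffQuot σ (-u) x z = -diffQuot σ u x z := by
  have h : fderiv ℝ (-u) x = -fderiv ℝ u x := fderiv_neg
  unfold diffQuot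
  rw [h]
  split_ifs <;> simp <;> ring

theorem levyOp_neg (σ : ℝ) (K u : Rn n → ℝ) (x : Rn n) :
    levyOp σ K (-u) x = -levyOp σ K u x := by
  simp only [levyOp, diffQuot_neg, neg_mul, integral_neg]

/-- At a minimum the gradient vanishes, so the integrand is nonnegative. The conventions for
`fderiv` and for the integral make differentiability and integrability unnecessary. -/
theorem levyOp_nonneg_of_isMinOn {K u : Rn n → ℝ} (hK : ∀ z, 0 ≤ K z) {x : Rn n}
    (h : IsMinOn u univ x) : 0 ≤ levyOp σ K u x := by
  have hgrad : fderiv ℝ u x = 0 := (h.isLocalMin Filter.univ_mem).fderiv_eq_zero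
  refine integral_nonneg fun z => mul_nonneg ?_ (hK z)
  have : u x ≤ u (x + z) := h (mem_univ _)
  unfold diffQuot
  rw [hgrad]
  split_ifs <;> simp [this]

/-- The lower half of uniform ellipticity, with its constants made explicit. -/
def EllipticWith (σ lam Lam mu : ℝ) (Ω : Set (Rn n)) (I : NonlocalOperator n) (C₀ : ℝ)
    (m : ℝ≥0 → ℝ≥0) : Prop :=
  ∀ (r s : ℝ), ∀ x ∈ Ω, ∀ δ : ℝ, 0 < δ → ∀ φ ψ : Rn n → ℝ,
    Admissible x δ φ → Admissible x δ ψ →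
    extremalInf σ lam Lam mu (φ - ψ) x
        - ((C₀ * ‖fderiv ℝ (ψ - φ) x‖ + (m (nndist r s) : ℝ) : ℝ) : EReal)
      ≤ ((I x r ψ - I x s φ : ℝ) : EReal)

/-- Monotonicity in the zero order variable lowers `s` to `-G`, and ellipticity then compares `(-G,
w)` with `(0, 0)`. Thus `m` is evaluated at one fixed point and need not be monotone. -/
theorem operator_nonneg_of_levyOp_le {C₀ C G : ℝ} {m : ℝ≥0 → ℝ≥0}
    (hI : EllipticWith σ lam Lam mu Ω I C₀ m) (hA2 : AssumptionA2 Ω I)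
    (hI0 : ∀ x ∈ Ω, |I x 0 (fun _ => 0)| ≤ C) {w : Rn n → ℝ} (hc : Continuous w)
    (hb : BoundedFun w) {x : Rn n} (hx : x ∈ Ω) (hw : ContDiffAt ℝ 2 w x)
    (hL : ∀ K, IsKernel σ lam Lam mu K →
      levyOp σ K w x + C₀ * ‖fderiv ℝ w x‖ ≤ -(C + m (nndist (-G) 0)))
    {s : ℝ} (hs : -G ≤ s) : 0 ≤ I x s w := by
  obtain ⟨δ, hδ, hadm⟩ := exists_admissible hc hb hw
  have hzero : Admissible x δ (fun _ : Rn n => (0 : ℝ)) :=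
    admissible_of_contDiff contDiff_const ⟨0, by simp⟩ x δ
  refine le_trans ?_ (hA2 x hx δ hδ w hadm _ _ hs)
  have h := hI (-G) 0 x hx δ hδ _ w hzero hadm
  have e1 : (fun _ : Rn n => (0 : ℝ)) - w = -w := by ext; simp
  have e2 : w - (fun _ : Rn n => (0 : ℝ)) = w := by ext; simp
  rw [e1, e2] at h
  have h' := real_le_of_ereal_le (v := C + m (nndist (-G) 0) + C₀ * ‖fderiv ℝ w x‖)
    (le_extremalInf fun K hK => by rw [levyOp_neg]; linarith [hL K hK]) h
  linarith [neg_abs_le (I x 0 (fun _ => 0)), hI0 x hx]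

/-- Ellipticity is applied to `w` and `φ` with equal zero order values: at the minimum of `w - φ`
the gradient and modulus terms vanish, and the infimum of the linear operators is nonnegative. -/
theorem operator_nonneg_of_touching {C₀ : ℝ} {m : ℝ≥0 → ℝ≥0} (hm : m 0 = 0)
    (hI : EllipticWith σ lam Lam mu Ω I C₀ m) {w φ : Rn n → ℝ} (hc : Continuous w)
    (hb : BoundedFun w) {x : Rn n} (hx : x ∈ Ω) (hw : ContDiffAt ℝ 2 w x)
    (hφ : ContDiff ℝ 2 φ) (hφb : BoundedFun φ) (hmin : IsMinOn (fun y => w y - φ y) univ x)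
    {s : ℝ} (hpos : 0 ≤ I x s w) : 0 ≤ I x s φ := by
  obtain ⟨δ, hδ, hadm⟩ := exists_admissible hc hb hw
  have h := hI s s x hx δ hδ w φ hadm (admissible_of_contDiff hφ hφb x δ)
  have hmax : IsMaxOn (φ - w) univ x := fun y hy => by
    have := hmin hy
    simp only [mem_ofPred_eq, Pi.sub_apply] at this ⊢
    linarith
  have hgrad : fderiv ℝ (φ - w) x = 0 := (hmax.isLocalMax Filter.univ_mem).fderiv_eq_zero
  rw [hgrad, nndist_self, hm] at h
  have h' := real_le_of_ereal_le (v := 0)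
    (le_extremalInf fun K hK => levyOp_nonneg_of_isMinOn hK.nonneg hmin) h
  simp only [norm_zero, mul_zero, NNReal.coe_zero, add_zero, sub_zero] at h'
  linarith

/-! ### Minima of truncated supersolutions and gluing -/

/-- Continuous functions between `g` and `T` that are viscosity supersolutions where they are
below `T`. -/
structure TruncatedSuper (I : NonlocalOperator n) (Ω : Set (Rn n)) (g : Rn n → ℝ) (T : ℝ)
    (w : Rn n → ℝ) : Prop where
  continuous : Continuous w
  ge : ∀ x, g x ≤ w x
  le : ∀ x, w x ≤ T
  touch : ∀ x ∈ Ω, w x < T → ∀ φ : Rn n → ℝ, ContDiff ℝ 2 φ → BoundedFun φ →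
    IsMinOn (fun y => w y - φ y) univ x → 0 ≤ I x (w x) φ

theorem isMinOn_sub_of_le {u w φ : Rn n → ℝ} {x : Rn n} (hle : ∀ y, u y ≤ w y) (hx : u x = w x)
    (h : IsMinOn (fun y => u y - φ y) univ x) : IsMinOn (fun y => w y - φ y) univ x := fun y hy => by
  have h1 := h hy
  simp only [mem_ofPred_eq] at h1 ⊢
  linarith [hle y]

/-- A test function touching the minimum from below also touches, at the same point, whichever
function attains it there. -/
theorem TruncatedSuper.min {g : Rn n → ℝ} {T : ℝ} {w₁ w₂ : Rn n → ℝ}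
    (h₁ : TruncatedSuper I Ω g T w₁) (h₂ : TruncatedSuper I Ω g T w₂) :
    TruncatedSuper I Ω g T (fun x => min (w₁ x) (w₂ x)) where
  continuous := h₁.continuous.min h₂.continuous
  ge x := le_min (h₁.ge x) (h₂.ge x)
  le x := (min_le_left _ _).trans (h₁.le x)
  touch x hx hT φ hφ hb hmin := by
    rcases le_total (w₁ x) (w₂ x) with h | h
    · have e : Min.min (w₁ x) (w₂ x) = w₁ x := min_eq_left h
      rw [e] at hT ⊢
      exact h₁.touch x hx hT φ hφ hb (isMinOn_sub_of_le (fun y => min_le_left _ _) e hmin)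
    · have e : Min.min (w₁ x) (w₂ x) = w₂ x := min_eq_right h
      rw [e] at hT ⊢
      exact h₂.touch x hx hT φ hφ hb (isMinOn_sub_of_le (fun y => min_le_right _ _) e hmin)

theorem TruncatedSuper.exists_finset_min {g : Rn n → ℝ} {T : ℝ} (hgT : ∀ x, g x ≤ T)
    {ι : Type*} (t : Finset ι) (W : ι → Rn n → ℝ)
    (hW : ∀ i ∈ t, TruncatedSuper I Ω g T (W i)) :
    ∃ v, TruncatedSuper I Ω g T v ∧ (∀ i ∈ t, ∀ x, v x ≤ W i x) ∧
      ∀ x, (∀ i ∈ t, W i x = T) → v x = T := by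
  classical
  induction t using Finset.induction_on with
  | empty =>
    exact ⟨fun _ => T, ⟨continuous_const, hgT, fun _ => le_rfl,
      fun x _ h => absurd h (lt_irrefl _)⟩, by simp, by simp⟩
  | insert i t hi ih =>
    obtain ⟨v, hv, hle, hT⟩ := ih fun j hj => hW j (Finset.mem_insert_of_mem hj)
    refine ⟨_, (hW i (Finset.mem_insert_self i t)).min hv, fun j hj x => ?_, fun x hx => ?_⟩
    · rcases Finset.mem_insert.1 hj with rfl | hj
      · exact min_le_left _ _
      · exact (min_le_right _ _).trans (hle j hj x)
    · rw [hx i (Finset.mem_insert_self i t),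
        hT x fun j hj => hx j (Finset.mem_insert_of_mem hj), min_self]

/-- Gluing: a global truncated supersolution and boundary barriers give a continuous
supersolution attaining the boundary values. -/
theorem exists_super_of_barriers (hΩo : IsOpen Ω) (hΩb : Bornology.IsBounded Ω)
    {g : Rn n → ℝ} (hgc : Continuous g) {G T : ℝ} (hgG : ∀ x, |g x| ≤ G)
    (hGT : G ≤ T) {w₀ : Rn n → ℝ} (hw₀ : TruncatedSuper I Ω g T w₀) (hw₀T : ∀ x ∈ Ω, w₀ x < T)
    (hbar : ∀ x₀ ∈ frontier Ω, ∀ ε : ℝ, 0 < ε → ∃ w, TruncatedSuper I Ω g T w ∧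
      w x₀ ≤ g x₀ + ε ∧ ∀ x, ε ≤ dist x x₀ → w x = T) :
    ∃ u : Rn n → ℝ, Continuous u ∧ IsDirichletSuper I Ω g u ∧ ∀ x ∈ Ωᶜ, u x = g x := by
  classical
  have hgT : ∀ x, g x ≤ T := fun x => (le_abs_self _).trans ((hgG x).trans hGT)
  have hcompact : IsCompact (frontier Ω) :=
    (hΩb.isCompact_closure).of_isClosed_subset isClosed_frontier frontier_subset_closure
  have hV : ∀ ε : ℝ, 0 < ε → ∃ v, TruncatedSuper I Ω g T v ∧
      (∀ x ∈ frontier Ω, v x < g x + 2 * ε) ∧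
      ∀ x, (∀ x₀ ∈ frontier Ω, ε ≤ dist x x₀) → v x = T := by
    intro ε hε
    choose! W hW1 hW2 hW3 using fun x₀ hx₀ => hbar x₀ hx₀ ε hε
    obtain ⟨t, ht, hcov⟩ := hcompact.elim_nhds_subcover (fun x₀ => {x | W x₀ x < g x + 2 * ε})
      fun x₀ hx₀ => (isOpen_lt (g := fun x => g x + 2 * ε)
        (hW1 x₀ hx₀).continuous (by fun_prop)).mem_nhds (by
          simp only [mem_ofPred_eq]; linarith [hW2 x₀ hx₀])
    obtain ⟨v, hv, hle, hvT⟩ := TruncatedSuper.exists_finset_min hgT t W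
      fun x₀ hx₀ => hW1 x₀ (ht x₀ hx₀)
    refine ⟨v, hv, fun x hx => ?_, fun x hx => hvT x fun x₀ hx₀ =>
      hW3 x₀ (ht x₀ hx₀) x (hx x₀ (ht x₀ hx₀))⟩
    obtain ⟨x₀, hx₀, hlt⟩ := mem_iUnion₂.1 (hcov hx)
    exact (hle x₀ hx₀ x).trans_lt hlt
  choose V hV1 hV2 hV3 using fun k : ℕ => hV (1 / ((k : ℝ) + 1)) (by positivity)
  -- `M k` is the minimum of `w₀` and `V 0, …, V (k - 1)`; in particular `V k` enters only at `M (k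
  -- + 1)`.
  let M : ℕ → Rn n → ℝ := fun k => Nat.rec w₀ (fun k f x => min (f x) (V k x)) k
  have hM : ∀ k, TruncatedSuper I Ω g T (M k) := fun k => by
    induction k with
    | zero => exact hw₀
    | succ k ih => exact ih.min (hV1 k)
  have hanti : ∀ x, Antitone fun k => M k x := fun x =>
    antitone_nat_of_succ_le fun k => min_le_left _ _
  have hbdd : ∀ x, BddBelow (range fun k => M k x) := fun x => ⟨g x, by
    rintro _ ⟨k, rfl⟩
    exact (hM k).ge x⟩
  -- Near `x` the functions `V j` equal `T` from some index on. Since `M j ≤ T`, taking the minimum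
  -- with them changes nothing, and the sequence is locally constant in `j`.
  have hstab : ∀ x ∈ Ω, ∃ k, ∀ᶠ y in 𝓝 x, (⨅ j, M j y) = M k y := by
    intro x hx
    obtain ⟨ε, hε, hball⟩ := Metric.isOpen_iff.1 hΩo x hx
    obtain ⟨k, hk⟩ := exists_nat_one_div_lt (half_pos hε)
    refine ⟨k, Filter.eventually_of_mem (ball_mem_nhds x (half_pos hε)) fun y hy => ?_⟩
    have hVT : ∀ j, k ≤ j → V j y = T := fun j hj => hV3 j y fun x₀ hx₀ => by
      have h1 : x₀ ∉ Ω := by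
        rw [hΩo.frontier_eq] at hx₀
        exact hx₀.2
      have h2 : ε ≤ dist x₀ x := not_lt.1 fun h => h1 (hball h)
      have h3 := dist_triangle x₀ y x
      have h4 : dist y x < ε / 2 := hy
      have h5 : 1 / ((j : ℝ) + 1) ≤ 1 / ((k : ℝ) + 1) :=
        one_div_le_one_div_of_le (by positivity) (by
          have : (k : ℝ) ≤ j := by exact_mod_cast hj
          linarith)
      rw [dist_comm y x₀]
      linarith
    have hconst : ∀ j, M k y ≤ M j y := fun j => by
      rcases le_total j k with h | h
      · exact hanti y h
      · induction j, h using Nat.le_induction with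
        | base => exact le_rfl
        | succ j hj ih => exact le_min ih (by rw [hVT j hj]; exact (hM k).le y)
    exact le_antisymm (ciInf_le (hbdd y) k) (le_ciInf hconst)
  let u : Rn n → ℝ := fun x => if x ∈ Ω then ⨅ j, M j x else g x
  have hu_in : ∀ x ∈ Ω, u x = ⨅ j, M j x := fun x hx => if_pos hx
  have hu_out : ∀ x ∉ Ω, u x = g x := fun x hx => if_neg hx
  have hu_ge : ∀ x, g x ≤ u x := fun x => by
    by_cases hx : x ∈ Ω
    · rw [hu_in x hx]
      exact le_ciInf fun j => (hM j).ge x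
    · exact (hu_out x hx).ge
  have hu_le : ∀ k x, u x ≤ M k x := fun k x => by
    by_cases hx : x ∈ Ω
    · rw [hu_in x hx]
      exact ciInf_le (hbdd x) k
    · exact (hu_out x hx).trans_le ((hM k).ge x)
  have hu_loc : ∀ x ∈ Ω, ∃ k, u =ᶠ[𝓝 x] M k := fun x hx => by
    obtain ⟨k, hk⟩ := hstab x hx
    exact ⟨k, by filter_upwards [hk, hΩo.mem_nhds hx] with y hy hyΩ; rw [hu_in y hyΩ, hy]⟩
  have hcont : Continuous u := by
    refine continuous_iff_continuousAt.2 fun x => ?_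
    by_cases hx : x ∈ Ω
    · obtain ⟨k, hk⟩ := hu_loc x hx
      exact (hM k).continuous.continuousAt.congr hk.symm
    -- Outside `Ω` continuity is a squeeze: `u ≥ g` gives the lower half, and at a boundary point `u
    -- ≤ M (k + 1)` with `M (k + 1) x < g x + 2 / (k + 1)` gives the upper half.
    refine tendsto_order.2 ⟨fun a ha => ?_, fun b hb => ?_⟩
    · rw [hu_out x hx] at ha
      exact (hgc.continuousAt.eventually (lt_mem_nhds ha)).mono fun y hy => hy.trans_le (hu_ge y)
    rw [hu_out x hx] at hb
    by_cases hxc : x ∈ closure Ω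
    · obtain ⟨k, hk⟩ := exists_nat_one_div_lt (half_pos (sub_pos.2 hb))
      have hxf : x ∈ frontier Ω := by
        rw [hΩo.frontier_eq]
        exact ⟨hxc, hx⟩
      have h1 : M (k + 1) x < b := (min_le_right _ _).trans_lt (by linarith [hV2 k x hxf])
      exact ((hM (k + 1)).continuous.continuousAt.eventually (gt_mem_nhds h1)).mono
        fun y hy => (hu_le (k + 1) y).trans_lt hy
    · filter_upwards [hgc.continuousAt.eventually (gt_mem_nhds hb),
        isClosed_closure.isOpen_compl.mem_nhds hxc] with y hy hyc
      rwa [hu_out y fun h => hyc (subset_closure h)]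
  refine ⟨u, hcont, ⟨⟨⟨T, fun x => abs_le.2 ⟨?_, (hu_le 0 x).trans ((hM 0).le x)⟩⟩,
    hcont.lowerSemicontinuous, fun φ hφ hφb x hx hmin => ?_⟩, fun x hx => hu_ge x⟩, hu_out⟩
  · linarith [hu_ge x, neg_abs_le (g x), hgG x]
  · obtain ⟨k, hk⟩ := hu_loc x hx
    have hk' := hk.eq_of_nhds
    rw [hk']
    exact (hM k).touch x hx ((hanti x (Nat.zero_le k)).trans_lt (hw₀T x hx)) φ hφ hφb
      (isMinOn_sub_of_le (hu_le k) hk' hmin)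

/-! ### Choice of the global and the boundary barriers -/

theorem truncatedSuper_barrier {C₀ C G : ℝ} {m : ℝ≥0 → ℝ≥0} (hm : m 0 = 0)
    (hI : EllipticWith σ lam Lam mu Ω I C₀ m) (hA2 : AssumptionA2 Ω I)
    (hI0 : ∀ x ∈ Ω, |I x 0 (fun _ => 0)| ≤ C) {g : Rn n → ℝ} (hgG : ∀ x, |g x| ≤ G)
    {y : Rn n} {R α A a T : ℝ} (hα : 0 ≤ α) (hR : 0 < R) (hA : 0 ≤ A)
    (hge : ∀ x, g x ≤ barrier y R α A a T x)
    (hstrict : ∀ x ∈ Ω, a + A * powDist y R α x < T → R < ‖x - y‖ ∧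
      ∀ K, IsKernel σ lam Lam mu K → levyOp σ K (barrier y R α A a T) x +
        C₀ * ‖fderiv ℝ (barrier y R α A a T) x‖ ≤ -(C + m (nndist (-G) 0))) :
    TruncatedSuper I Ω g T (barrier y R α A a T) where
  continuous := continuous_barrier y R A a T hα
  ge := hge
  le x := min_le_right _ _
  touch x hx hT φ hφ hφb hmin := by
    have hT' : a + A * powDist y R α x < T := (min_lt_iff.1 hT).resolve_right (lt_irrefl T)
    obtain ⟨hxR, hL⟩ := hstrict x hx hT'
    have hc := continuous_barrier y R A a T hα
    have hb := boundedFun_barrier y R α a T hA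
    have hw := contDiffAt_barrier hα hR hxR hT'
    refine operator_nonneg_of_touching hm hI hc hb hx hw hφ hφb hmin
      (operator_nonneg_of_levyOp_le hI hA2 hI0 hc hb hx hw hL ?_)
    linarith [hge x, neg_abs_le (g x), hgG x]

theorem exists_dirichletSuper (hn : 1 ≤ n) (hσ0 : 0 < σ) (hσ2 : σ < 2) (hlam : 0 < lam)
    (hLam : lam ≤ Lam) (hmu : 0 < mu) (hΩo : IsOpen Ω) (hΩb : Bornology.IsBounded Ω)
    (hΩe : UniformExteriorBall Ω) (hI : UniformlyElliptic σ lam Lam mu Ω I)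
    (hA2 : AssumptionA2 Ω I) (hI0 : ∃ C : ℝ, ∀ x ∈ Ω, |I x 0 (fun _ => 0)| ≤ C)
    {g : Rn n → ℝ} (hgc : Continuous g) (hgb : BoundedFun g) :
    ∃ u : Rn n → ℝ, Continuous u ∧ IsDirichletSuper I Ω g u ∧ ∀ x ∈ Ωᶜ, u x = g x := by
  obtain ⟨C₀, m, hC₀, hC₀', hm, hell⟩ := hI
  have hI' : EllipticWith σ lam Lam mu Ω I C₀ m := fun r s x hx δ hδ φ ψ hφ hψ =>
    (hell r s x hx δ hδ φ ψ hφ hψ).1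
  obtain ⟨C, hC⟩ := hI0
  obtain ⟨G, hG⟩ := hgb
  obtain ⟨r₀, hr₀, hext⟩ := hΩe
  have hG0 : 0 ≤ G := (abs_nonneg _).trans (hG 0)
  have hL : 0 ≤ (2 - σ) * Lam := mul_nonneg (by linarith) (by linarith)
  obtain ⟨κ, hκ, hκD⟩ := exists_barrier_constants (Lam := Lam) hn hσ0 hσ2 hlam hmu hL hC₀ hC₀'
  obtain ⟨ρ, hρ, hΩρ⟩ := hΩb.subset_ball_lt 0 0
  obtain ⟨α, c, hα, hc, hbar⟩ := hκD (2 * ρ) (by positivity)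
  set C₁ := max (C + m (nndist (-G) 0)) 0 with hC₁
  have hA₀ : 0 ≤ C₁ / c := div_nonneg (le_max_right _ _) hc.le
  have hAc : ∀ A, C₁ / c ≤ A → -(A * c) ≤ -(C + m (nndist (-G) 0)) := fun A hA => by
    rw [div_le_iff₀ hc] at hA
    linarith [le_max_left (C + (m (nndist (-G) 0) : ℝ)) 0]
  -- On `Ω` the global barrier is at most `G + C₁ / c * (2ρ)^α`; the extra `1` keeps it strictly
  -- below `T`.
  set T := G + C₁ / c * (2 * ρ) ^ α + 1 with hT
  have hGT : G ≤ T := by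
    have : 0 ≤ C₁ / c * (2 * ρ) ^ α := by positivity
    linarith
  set e : Rn n := EuclideanSpace.single (⟨0, hn⟩ : Fin n) (1 : ℝ) with he
  have he1 : ‖e‖ = 1 := by rw [he, PiLp.norm_single]; norm_num
  -- The ball `B_R(y)` is placed so that `Ω ⊆ B_ρ` lies at distance between `0` and `2ρ = κR` from
  -- it, within the range of the barrier estimate.
  set R := 2 * ρ / κ with hR_def
  have hR : 0 < R := by positivity
  have hκR : κ * R = 2 * ρ := by rw [hR_def]; field_simp
  set y := -((R + ρ) • e) with hy
  have hynorm : ‖y‖ = R + ρ := by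
    rw [hy, norm_neg, norm_smul, he1, mul_one, Real.norm_of_nonneg (by positivity)]
  have hfar : ∀ x ∈ Ω, R < ‖x - y‖ ∧ ‖x - y‖ - R ≤ 2 * ρ := fun x hx => by
    have h1 : ‖x‖ < ρ := by simpa using hΩρ hx
    have h2 := norm_sub_norm_le y x
    have h3 := norm_sub_le x y
    rw [norm_sub_rev] at h2
    constructor <;> linarith
  have hw₀lt : ∀ x ∈ Ω, G + C₁ / c * powDist y R α x < T := fun x hx => by
    obtain ⟨h1, h2⟩ := hfar x hx
    have : powDist y R α x ≤ (2 * ρ) ^ α := by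
      rw [powDist_of_le h1.le]
      exact Real.rpow_le_rpow (by linarith) h2 hα.le
    have := mul_le_mul_of_nonneg_left this hA₀
    linarith
  refine exists_super_of_barriers hΩo hΩb hgc hG hGT (w₀ := barrier y R α (C₁ / c) G T)
    (truncatedSuper_barrier hm.1 hI' hA2 hC hG hα.le hR hA₀ (fun x => ?_)
      fun x hx hxT => ⟨(hfar x hx).1, fun K hK => ?_⟩)
    (fun x hx => (min_le_left _ _).trans_lt (hw₀lt x hx)) ?_
  · have := mul_nonneg hA₀ (powDist_nonneg y R α x)
    exact le_min (by linarith [le_abs_self (g x), hG x]) (by linarith [le_abs_self (g x), hG x])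
  · exact (hbar y x R _ G T hR (hfar x hx).1 (by rw [hκR]; exact (hfar x hx).2) (hfar x hx).2 hA₀
      hxT K hK).trans (hAc _ le_rfl)
  intro x₀ hx₀ ε hε
  obtain ⟨η, hη, hgη⟩ := Metric.continuous_iff.1 hgc x₀ ε hε
  -- The bound `η/3` secures `barrier ≥ g`, the bound `ε/3` makes the barrier equal `T` at distance
  -- `ε` from `x₀`, and `r ≤ R` gives `κr ≤ 2ρ`, the admissible distance.
  set r := min (min r₀ (η / 3)) (min (ε / 3) R) with hr_def
  have hr : 0 < r := by positivity
  have hrr₀ : r ≤ r₀ := (min_le_left _ _).trans (min_le_left _ _)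
  have hrη : 3 * r ≤ η := by
    have : r ≤ η / 3 := (min_le_left _ _).trans (min_le_right _ _)
    linarith
  have hrε : 3 * r ≤ ε := by
    have : r ≤ ε / 3 := (min_le_right _ _).trans (min_le_left _ _)
    linarith
  have hrR : r ≤ R := (min_le_right _ _).trans (min_le_right _ _)
  obtain ⟨z, -, hz⟩ := hext x₀ hx₀ r hr hrr₀
  have hx₀z : ‖x₀ - z‖ ≤ r := by
    have : x₀ ∈ closedBall z r ∩ closure Ω := by rw [hz]; rfl
    exact mem_closedBall_iff_norm.1 this.1
  have hx₀Ω : x₀ ∉ Ω := by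
    rw [hΩo.frontier_eq] at hx₀
    exact hx₀.2
  have hout : ∀ x ∈ Ω, r < ‖x - z‖ := fun x hx => not_le.1 fun h => by
    have : x ∈ closedBall z r ∩ closure Ω := ⟨mem_closedBall_iff_norm.2 h, subset_closure hx⟩
    rw [hz] at this
    exact hx₀Ω (this ▸ hx)
  -- The barrier must reach `T` within distance `τ ≤ κr` of the ball, so that it is below `T` only
  -- where it is strict. The choice of `A` gives `A τ^α ≥ T + G`, enough since `g x₀ ≥ -G`.
  set τ := min κ 1 * r with hτ_def
  have hτ : 0 < τ := by positivity
  set A := max (C₁ / c) ((T + G) / τ ^ α) with hA_def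
  have hA : 0 ≤ A := hA₀.trans (le_max_left _ _)
  have hbig : ∀ x, τ ≤ ‖x - z‖ - r → T ≤ g x₀ + ε + A * powDist z r α x := fun x hx => by
    have h1 : τ ^ α ≤ powDist z r α x := by
      rw [powDist_of_le (by linarith)]
      exact Real.rpow_le_rpow hτ.le hx hα.le
    have h2 : T + G ≤ A * τ ^ α := (div_le_iff₀ (by positivity)).1 (le_max_right _ _)
    have h3 := mul_le_mul_of_nonneg_left h1 hA
    linarith [neg_abs_le (g x₀), hG x₀]
  have hTfar : ∀ x, 3 * r ≤ dist x x₀ → T ≤ g x₀ + ε + A * powDist z r α x := fun x hx => by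
    refine hbig x ?_
    have h1 : ‖x - x₀‖ ≤ ‖x - z‖ + ‖x₀ - z‖ := by
      have := norm_sub_le (x - z) (x₀ - z)
      rwa [sub_sub_sub_cancel_right] at this
    have h2 : τ ≤ r := mul_le_of_le_one_left hr.le (min_le_right _ _)
    rw [dist_eq_norm] at hx
    linarith
  refine ⟨barrier z r α A (g x₀ + ε) T,
    truncatedSuper_barrier hm.1 hI' hA2 hC hG hα.le hr hA (fun x => ?_)
      fun x hx hxT => ⟨hout x hx, fun K hK => ?_⟩, ?_, fun x hx => ?_⟩
  · have hgT : g x ≤ T := (le_abs_self _).trans ((hG x).trans hGT)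
    refine le_min ?_ hgT
    rcases lt_or_ge (dist x x₀) η with h | h
    · have h1 := abs_lt.1 (Real.dist_eq (g x) (g x₀) ▸ hgη x h)
      have h2 := mul_nonneg hA (powDist_nonneg z r α x)
      linarith
    · exact hgT.trans (hTfar x (hrη.trans h))
  · have hd : ‖x - z‖ - r < τ := not_le.1 fun h => (hbig x h).not_gt hxT
    have hd1 : ‖x - z‖ - r ≤ κ * r :=
      hd.le.trans (mul_le_mul_of_nonneg_right (min_le_left _ _) hr.le)
    have hd2 : ‖x - z‖ - r ≤ 2 * ρ :=
      hd1.trans ((mul_le_mul_of_nonneg_left hrR hκ.le).trans_eq hκR)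
    exact (hbar z x r A _ T hr (hout x hx) hd1 hd2 hA hxT K hK).trans (hAc _ (le_max_left _ _))
  · refine (min_le_left _ _).trans ?_
    rw [powDist_eq_zero hα.ne' hx₀z, mul_zero, add_zero]
  · exact min_eq_right (hTfar x (hrε.trans hx))

/-! ### Duality between subsolutions and supersolutions -/

/-- The operator whose supersolutions are the negatives of the subsolutions of `I`. -/
def dualOperator (I : NonlocalOperator n) : NonlocalOperator n := fun x r φ => -I x (-r) (-φ)

theorem Admissible.neg {φ : Rn n → ℝ} {x : Rn n} {δ : ℝ} (h : Admissible x δ φ) :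
    Admissible x δ (-φ) :=
  ⟨h.1.neg, h.2.neg⟩

/-- Negating the arguments and the value while exchanging the two pairs leaves both `φ - ψ` and the
difference of values unchanged, so each half of the ellipticity condition is carried to itself. -/
theorem UniformlyElliptic.dual (hI : UniformlyElliptic σ lam Lam mu Ω I) :
    UniformlyElliptic σ lam Lam mu Ω (dualOperator I) := by
  obtain ⟨C₀, m, hC₀, hC₀', hm, h⟩ := hI
  refine ⟨C₀, m, hC₀, hC₀', hm, fun r s x hx δ hδ φ ψ hφ hψ => ?_⟩
  have h' := h (-s) (-r) x hx δ hδ (-ψ) (-φ) hψ.neg hφ.neg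
  have e1 : -ψ - -φ = φ - ψ := by abel
  have e2 : -φ - -ψ = ψ - φ := by abel
  have e3 : nndist (-s) (-r) = nndist r s := by rw [nndist_neg_neg, nndist_comm]
  have e4 : dualOperator I x r ψ - dualOperator I x s φ = I x (-s) (-φ) - I x (-r) (-ψ) := by
    simp only [dualOperator]; ring
  rwa [e1, e2, e3, ← e4] at h'

theorem AssumptionA2.dual (h : AssumptionA2 Ω I) : AssumptionA2 Ω (dualOperator I) :=
  fun x hx δ hδ φ hφ r s hrs =>
    neg_le_neg (h x hx δ hδ (-φ) hφ.neg (-s) (-r) (neg_le_neg hrs))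

theorem BoundedFun.neg {u : Rn n → ℝ} (h : BoundedFun u) : BoundedFun (fun x => -u x) := by
  obtain ⟨C, hC⟩ := h
  exact ⟨C, fun x => by rw [abs_neg]; exact hC x⟩

theorem IsDirichletSuper.neg {g u : Rn n → ℝ} (hc : Continuous u)
    (h : IsDirichletSuper (dualOperator I) Ω (fun x => -g x) u) :
    IsDirichletSub I Ω g (fun x => -u x) := by
  obtain ⟨⟨hb, -, ht⟩, hg⟩ := h
  refine ⟨⟨hb.neg, hc.neg.upperSemicontinuous, fun φ hφ hφb x hx hmax => ?_⟩,
    fun x hx => neg_le.1 (hg x hx)⟩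
  have h := ht (fun y => -φ y) hφ.neg hφb.neg x hx fun y hy => by
    have := hmax hy
    simp only [mem_ofPred_eq] at this ⊢
    linarith
  have e : -(fun y => -φ y) = φ := by ext; simp
  rw [dualOperator, e] at h
  linarith

end NonlocalDirichlet

theorem theorem5p3 (n : ℕ) (hn : 1 ≤ n) (σ lam Lam mu : ℝ) (hσ0 : 0 < σ) (hσ2 : σ < 2)
    (hlam : 0 < lam) (hLam : lam ≤ Lam) (hmu : 0 < mu)
    (Ω : Set (Rn n)) (hΩo : IsOpen Ω) (hΩb : Bornology.IsBounded Ω)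
    (hΩe : UniformExteriorBall Ω)
    (I : NonlocalOperator n) (hI : UniformlyElliptic σ lam Lam mu Ω I)
    (hA0 : AssumptionA0 Ω I) (hA2 : AssumptionA2 Ω I)
    (hI0 : ∃ C : ℝ, ∀ x ∈ Ω, |I x 0 (fun _ => 0)| ≤ C)
    (g : Rn n → ℝ) (hgc : Continuous g) (hgb : BoundedFun g) :
    (∃ u : Rn n → ℝ, Continuous u ∧ IsDirichletSuper I Ω g u ∧ ∀ x ∈ Ωᶜ, u x = g x) ∧
    (∃ v : Rn n → ℝ, Continuous v ∧ IsDirichletSub I Ω g v ∧ ∀ x ∈ Ωᶜ, v x = g x) := by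
  refine ⟨exists_dirichletSuper hn hσ0 hσ2 hlam hLam hmu hΩo hΩb hΩe hI hA2 hI0 hgc hgb, ?_⟩
  have hI0' : ∃ C : ℝ, ∀ x ∈ Ω, |dualOperator I x 0 (fun _ => 0)| ≤ C := by
    obtain ⟨C, hC⟩ := hI0
    refine ⟨C, fun x hx => ?_⟩
    have e : -(fun _ : Rn n => (0 : ℝ)) = fun _ => 0 := by ext; simp
    rw [dualOperator, abs_neg, neg_zero, e]
    exact hC x hx
  obtain ⟨u, huc, hu, hug⟩ := exists_dirichletSuper hn hσ0 hσ2 hlam hLam hmu hΩo hΩb hΩe hI.dual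
    hA2.dual hI0' hgc.neg hgb.neg
  exact ⟨fun x => -u x, huc.neg, hu.neg huc, fun x hx => by simp [hug x hx]⟩
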